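/- Let $m,k\ge 1$ be integers, $n=2m$, $q=2^n$, with $1\le k\le n-1$ and $k\ne m$. Let $d=\gcd(m,k)$ and $d'=\gcd(m+k,2k)$. Let $\mathbb F_q$ be the field with $q$ elements, $\mathbb F_{2^m}$ its subfield of order $2^m$, $\mathrm{Tr}_1^m:\mathbb F_{2^m}\to\mathbb F_2$ and $\mathrm{Tr}_1^n:\mathbb F_q\to\mathbb F_2$ the absolute traces, and $\pi$ a primitive element of $\mathbb F_q$. For $\alpha\in\mathbb F_{2^m}$ and $\beta,\gamma\in\mathbb F_q$ put \[ S(\alpha,\beta,\gamma)=\sum_{x\in\mathbb F_q}(-1)^{\mathrm{Tr}_1^m(\alpha x^{2^m+1})+\mathrm{Tr}_1^n(\beta x^{2^k+1}+\gamma x)},\] \[ c(\alpha,\beta,\gamma)=\Bigl(\mathrm{Tr}_1^m(\alpha\pi^{i(2^m+1)})+\mathrm{Tr}_1^n(\beta\pi^{i(2^k+1)}+\gamma\pi^i)\Bigr)_{i=0}^{q-2}\in\mathbb F_2^{\,q-1}.\] Let $h_1,h_2,h_3$ be the minimal polynomials over $\mathbb F_2$ of $\pi^{-1}$, $\pi^{-(2^k+1)}$,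 $\pi^{-(2^m+1)}$, and let $\mathcal C_2$ be the binary cyclic code of length $q-1$ with parity-check polynomial $h_1h_2h_3$, that is, the set of all words $(c_0,\dots,c_{q-2})$ with $h_1h_2h_3\cdot\sum_i c_iX^i\equiv 0 \pmod{X^{q-1}-1}$. Then $(\alpha,\beta,\gamma)\mapsto c(\alpha,\beta,\gamma)$ is a bijection from $\mathbb F_{2^m}\times\mathbb F_q^2$ onto $\mathcal C_2$. Moreover, the tables below give the value distribution of $S$ and the weight distribution of $\mathcal C_2$ completely. That is, for every triple $(\alpha,\beta,\gamma)$ there is a row containing both the value $S(\alpha,\beta,\gamma)$ and the Hamming weight of $c(\alpha,\beta,\gamma)$; for every row the number of triples $(\alpha,\beta,\gamma)$ for which $S(\alpha,\beta,\gamma)$ is the listed value is the listed multiplicity; every codeword of $\mathcal C_2$ has one of the listed weights; and for every row the number of codewords of $\mathcal C_2$ of the listed weight is the listed multiplicity. (i) If $d'=d$: \[\begin{array}{|c|c|c|}\hline \text{value}&\text{weight}&\text{multiplicity}\\\hline 2^m&2^{n-1}-2^{m-1}&\dfrac{2^{m-1}(2^n-1)(2^{n+2d}-2^{n+d}-2^n+2^{m+2d}-2^{m+d}+2^{2d})}{2^{2d}-1}\\\hline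 -2^m&2^{n-1}+2^{m-1}&\dfrac{2^{m-1}(2^m-1)^2(2^{n+2d}-2^{n+d}-2^n+2^{m+2d}-2^{m+d}+2^{2d})}{2^{2d}-1}\\\hline 2^{m+d}&2^{n-1}-2^{m+d-1}&\dfrac{2^{m-d-1}(2^{m-d}+1)(2^{m+d}-1)(2^n-1)}{2^{2d}-1}\\\hline -2^{m+d}&2^{n-1}+2^{m+d-1}&\dfrac{2^{m-d-1}(2^{m-d}-1)(2^{m+d}-1)(2^n-1)}{2^{2d}-1}\\\hline 0&2^{n-1}&(2^{3m-d}-2^{n-2d}+1)(2^n-1)\\\hline 2^n&0&1\\\hline \end{array}\] (ii) If $d'=2d$: \[\begin{array}{|c|c|c|}\hline \text{value}&\text{weight}&\text{multiplicity}\\\hline 2^m&2^{n-1}-2^{m-1}&\dfrac{2^{m+3d-1}(2^n-1)(2^n-2^{n-2d}-2^{n-3d}+2^m-2^{m-d}+1)}{(2^d+1)(2^{2d}-1)}\\\hline -2^m&2^{n-1}+2^{m-1}&\dfrac{2^{m+3d-1}(2^m-1)^2(2^n-2^{n-2d}-2^{n-3d}+2^m-2^{m-d}+1)}{(2^d+1)(2^{2d}-1)}\\\hline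 2^{m+d}&2^{n-1}-2^{m+d-1}&\dfrac{2^{m-1}(2^{m-d}+1)(2^n-1)(2^m+2^{m-d}+2^{m-2d}+1)}{(2^d+1)^2}\\\hline -2^{m+d}&2^{n-1}+2^{m+d-1}&\dfrac{2^{m-1}(2^{m-d}-1)(2^n-1)(2^m+2^{m-d}+2^{m-2d}+1)}{(2^d+1)^2}\\\hline 2^{m+2d}&2^{n-1}-2^{m+2d-1}&\dfrac{2^{m-2d-1}(2^{m-2d}+1)(2^{m-d}-1)(2^n-1)}{(2^d+1)(2^{2d}-1)}\\\hline -2^{m+2d}&2^{n-1}+2^{m+2d-1}&\dfrac{2^{m-2d-1}(2^{m-2d}-1)(2^{m-d}-1)(2^n-1)}{(2^d+1)(2^{2d}-1)}\\\hline 0&2^{n-1}&\begin{array}{c}(2^n-1)\bigl(2^{3m-d}-2^{3m-2d}+2^{3m-3d}-2^{3m-4d}+2^{3m-5d}\\{}+2^{n-d}-2^{n-2d+1}+2^{n-3d}-2^{n-4d}+1\bigr)\end{array}\\\hline 2^n&0&1\\\hline \end{array}\] -/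

import Mathlib

open Polynomial

noncomputable section

namespace GenKasami

/-- The subfield of `F` formed by the roots of `x ^ (2 ^ m) = x`; when `F` has `2 ^ (2 * m)` elements
this is the subfield of order `2 ^ m`. -/
def subfieldPow (F : Type*) [Field F] [Algebra (ZMod 2) F] (m : ℕ) :
    IntermediateField (ZMod 2) F where
  carrier := {x | x ^ 2 ^ m = x}
  mul_mem' := by
    intro a b ha hb
    simp only [Set.mem_ofPred_eq] at *
    rw [mul_pow, ha, hb]
  one_mem' := by simp
  add_mem' := by
    intro a b ha hb
    have : CharP F 2 := charP_of_injective_algebraMap (algebraMap (ZMod 2) F).injective 2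
    simp only [Set.mem_ofPred_eq] at *
    rw [add_pow_char_pow, ha, hb]
  zero_mem' := by simp
  algebraMap_mem' := by
    intro r
    simp only [Set.mem_ofPred_eq]
    rw [← map_pow, ZMod.pow_card_pow]
  inv_mem' := by
    intro a ha
    simp only [Set.mem_ofPred_eq] at *
    rw [inv_pow, ha]

section Sums

variable {F : Type*} [Field F] [Fintype F] [Algebra (ZMod 2) F] {n m : ℕ}

/-- `x ^ (2 ^ m + 1)` as an element of the subfield of order `2 ^ m`. -/
def powElt (hn : n = 2 * m) (hF : Fintype.card F = 2 ^ n) (x : F) : subfieldPow F m :=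
  ⟨x ^ (2 ^ m + 1), by
    change (x ^ (2 ^ m + 1)) ^ 2 ^ m = x ^ (2 ^ m + 1)
    have h : x ^ (2 ^ m * 2 ^ m) = x := by
      have h1 := FiniteField.pow_card x
      rwa [hF, hn, two_mul, pow_add] at h1
    rw [← pow_mul, add_mul, one_mul, pow_add, h, pow_succ, mul_comm]⟩

/-- `Tr_1^m (α x ^ (2 ^ m + 1)) + Tr_1^n (β x ^ (2 ^ k + 1) + γ x)`, an element of the prime field. -/
def phase (hn : n = 2 * m) (hF : Fintype.card F = 2 ^ n) (k : ℕ)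
    (α : subfieldPow F m) (β γ : F) (x : F) : ZMod 2 :=
  Algebra.trace (ZMod 2) (subfieldPow F m) (α * powElt hn hF x) +
    Algebra.trace (ZMod 2) F (β * x ^ (2 ^ k + 1) + γ * x)

/-- The exponential sum `S(α, β, γ)`. -/
def expSum (hn : n = 2 * m) (hF : Fintype.card F = 2 ^ n) (k : ℕ)
    (α : subfieldPow F m) (β γ : F) : ℤ :=
  ∑ x : F, (-1) ^ (phase hn hF k α β γ x).val

/-- The word `c(α, β, γ)` of length `q - 1`, whose `i`-th entry is
`Tr_1^m (α π ^ (i (2 ^ m + 1))) + Tr_1^n (β π ^ (i (2 ^ k + 1)) + γ π ^ i)`. -/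
def word (hn : n = 2 * m) (hF : Fintype.card F = 2 ^ n) (k : ℕ) (π : F)
    (α : subfieldPow F m) (β γ : F) : Fin (2 ^ n - 1) → ZMod 2 :=
  fun i => phase hn hF k α β γ (π ^ (i : ℕ))

end Sums

/-- The polynomial `c_0 + c_1 X + ... + c_(l-1) X ^ (l-1)` of a binary word of length `l`. -/
def wordPoly {l : ℕ} (c : Fin l → ZMod 2) : (ZMod 2)[X] :=
  ∑ i : Fin l, C (c i) * X ^ (i : ℕ)

/-- The binary cyclic code of length `l` with parity-check polynomial `h` (a divisor of `X ^ l - 1`):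
the words `c` with `h(X) c(X) = 0` modulo `X ^ l - 1`. -/
def cyclicCode (l : ℕ) (h : (ZMod 2)[X]) : Submodule (ZMod 2) (Fin l → ZMod 2) where
  carrier := {c | (X ^ l - 1 : (ZMod 2)[X]) ∣ h * wordPoly c}
  zero_mem' := by simp [wordPoly]
  add_mem' := by
    intro a b ha hb
    have h1 : wordPoly (a + b) = wordPoly a + wordPoly b := by
      simp [wordPoly, add_mul, Finset.sum_add_distrib]
    simp only [Set.mem_ofPred_eq] at *
    rw [h1, mul_add]
    exact dvd_add ha hb
  smul_mem' := by
    intro r a ha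
    have h1 : wordPoly (r • a) = C r * wordPoly a := by
      simp [wordPoly, Finset.mul_sum, mul_assoc]
    simp only [Set.mem_ofPred_eq] at *
    rw [h1, mul_left_comm]
    exact Dvd.dvd.mul_left ha _

/-- For a divisor `h` of `X ^ l - 1`, the code is generated by `g = (X ^ l - 1) / h`. -/
theorem mem_cyclicCode_iff {l : ℕ} {g h : (ZMod 2)[X]} (hh : h ≠ 0)
    (hgh : h * g = X ^ l - 1) (c : Fin l → ZMod 2) :
    c ∈ cyclicCode l h ↔ g ∣ wordPoly c := by
  change (X ^ l - 1 : (ZMod 2)[X]) ∣ h * wordPoly c ↔ _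
  rw [← hgh, mul_dvd_mul_iff_left hh]

/-- The code `C₂` of length `2 ^ n - 1` with parity-check polynomial `h₁ h₂ h₃`, where `h₁`, `h₂`, `h₃`
are the minimal polynomials of `π⁻¹`, `π ^ (-(2 ^ k + 1))`, `π ^ (-(2 ^ m + 1))`. -/
def codeC2 {F : Type*} [Field F] [Algebra (ZMod 2) F] (n m k : ℕ) (π : F) :
    Submodule (ZMod 2) (Fin (2 ^ n - 1) → ZMod 2) :=
  cyclicCode (2 ^ n - 1)
    (minpoly (ZMod 2) π⁻¹ * minpoly (ZMod 2) (π ^ (2 ^ k + 1))⁻¹ *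
      minpoly (ZMod 2) (π ^ (2 ^ m + 1))⁻¹)

/-- A row of a distribution table: a value of the exponential sum, the Hamming weight of the
corresponding words, and the multiplicity. -/
structure Row where
  value : ℚ
  weight : ℚ
  mult : ℚ

/-- The table for `d' = d`. The exponents are integers, so no subtraction is truncated. -/
def tableOne (n m d : ℤ) : List Row :=
  [ ⟨2 ^ m, 2 ^ (n - 1) - 2 ^ (m - 1),
      2 ^ (m - 1) * (2 ^ n - 1) *
        (2 ^ (n + 2 * d) - 2 ^ (n + d) - 2 ^ n + 2 ^ (m + 2 * d) - 2 ^ (m + d) + 2 ^ (2 * d)) /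
        (2 ^ (2 * d) - 1)⟩,
    ⟨-2 ^ m, 2 ^ (n - 1) + 2 ^ (m - 1),
      2 ^ (m - 1) * (2 ^ m - 1) ^ 2 *
        (2 ^ (n + 2 * d) - 2 ^ (n + d) - 2 ^ n + 2 ^ (m + 2 * d) - 2 ^ (m + d) + 2 ^ (2 * d)) /
        (2 ^ (2 * d) - 1)⟩,
    ⟨2 ^ (m + d), 2 ^ (n - 1) - 2 ^ (m + d - 1),
      2 ^ (m - d - 1) * (2 ^ (m - d) + 1) * (2 ^ (m + d) - 1) * (2 ^ n - 1) /
        (2 ^ (2 * d) - 1)⟩,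
    ⟨-2 ^ (m + d), 2 ^ (n - 1) + 2 ^ (m + d - 1),
      2 ^ (m - d - 1) * (2 ^ (m - d) - 1) * (2 ^ (m + d) - 1) * (2 ^ n - 1) /
        (2 ^ (2 * d) - 1)⟩,
    ⟨0, 2 ^ (n - 1), (2 ^ (3 * m - d) - 2 ^ (n - 2 * d) + 1) * (2 ^ n - 1)⟩,
    ⟨2 ^ n, 0, 1⟩ ]

/-- The table for `d' = 2 d`. -/
def tableTwo (n m d : ℤ) : List Row :=
  [ ⟨2 ^ m, 2 ^ (n - 1) - 2 ^ (m - 1),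
      2 ^ (m + 3 * d - 1) * (2 ^ n - 1) *
        (2 ^ n - 2 ^ (n - 2 * d) - 2 ^ (n - 3 * d) + 2 ^ m - 2 ^ (m - d) + 1) /
        ((2 ^ d + 1) * (2 ^ (2 * d) - 1))⟩,
    ⟨-2 ^ m, 2 ^ (n - 1) + 2 ^ (m - 1),
      2 ^ (m + 3 * d - 1) * (2 ^ m - 1) ^ 2 *
        (2 ^ n - 2 ^ (n - 2 * d) - 2 ^ (n - 3 * d) + 2 ^ m - 2 ^ (m - d) + 1) /
        ((2 ^ d + 1) * (2 ^ (2 * d) - 1))⟩,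
    ⟨2 ^ (m + d), 2 ^ (n - 1) - 2 ^ (m + d - 1),
      2 ^ (m - 1) * (2 ^ (m - d) + 1) * (2 ^ n - 1) *
        (2 ^ m + 2 ^ (m - d) + 2 ^ (m - 2 * d) + 1) / (2 ^ d + 1) ^ 2⟩,
    ⟨-2 ^ (m + d), 2 ^ (n - 1) + 2 ^ (m + d - 1),
      2 ^ (m - 1) * (2 ^ (m - d) - 1) * (2 ^ n - 1) *
        (2 ^ m + 2 ^ (m - d) + 2 ^ (m - 2 * d) + 1) / (2 ^ d + 1) ^ 2⟩,
    ⟨2 ^ (m + 2 * d), 2 ^ (n - 1) - 2 ^ (m + 2 * d - 1),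
      2 ^ (m - 2 * d - 1) * (2 ^ (m - 2 * d) + 1) * (2 ^ (m - d) - 1) * (2 ^ n - 1) /
        ((2 ^ d + 1) * (2 ^ (2 * d) - 1))⟩,
    ⟨-2 ^ (m + 2 * d), 2 ^ (n - 1) + 2 ^ (m + 2 * d - 1),
      2 ^ (m - 2 * d - 1) * (2 ^ (m - 2 * d) - 1) * (2 ^ (m - d) - 1) * (2 ^ n - 1) /
        ((2 ^ d + 1) * (2 ^ (2 * d) - 1))⟩,
    ⟨0, 2 ^ (n - 1),
      (2 ^ n - 1) *
        (2 ^ (3 * m - d) - 2 ^ (3 * m - 2 * d) + 2 ^ (3 * m - 3 * d) - 2 ^ (3 * m - 4 * d) +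
          2 ^ (3 * m - 5 * d) + 2 ^ (n - d) - 2 ^ (n - 2 * d + 1) + 2 ^ (n - 3 * d) -
          2 ^ (n - 4 * d) + 1)⟩,
    ⟨2 ^ n, 0, 1⟩ ]

/-- The table `t` is the complete value distribution of `S(α, β, γ)`, with the weights of the words
`c(α, β, γ)`, and the complete weight distribution of `C₂`. -/
structure IsDistribution {F : Type*} [Field F] [Fintype F] [Algebra (ZMod 2) F] {n m : ℕ}
    (hn : n = 2 * m) (hF : Fintype.card F = 2 ^ n) (k : ℕ) (π : F) (t : List Row) : Prop where
  /-- Every triple belongs to a row: its sum and the weight of its word are those of the row. -/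
  complete : ∀ (α : subfieldPow F m) (β γ : F), ∃ r ∈ t,
    (expSum hn hF k α β γ : ℚ) = r.value ∧
      (hammingNorm (word hn hF k π α β γ) : ℚ) = r.weight
  /-- The number of triples with a given value of the sum. -/
  value_mult : ∀ r ∈ t,
    (Nat.card {p : subfieldPow F m × F × F //
      (expSum hn hF k p.1 p.2.1 p.2.2 : ℚ) = r.value} : ℚ) = r.mult
  /-- Every weight of a codeword is listed. -/
  code_complete : ∀ c ∈ codeC2 n m k π, ∃ r ∈ t, (hammingNorm c : ℚ) = r.weight
  /-- The number of codewords with a given weight. -/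
  weight_mult : ∀ r ∈ t,
    (Nat.card {c : codeC2 n m k π //
      (hammingNorm (c : Fin (2 ^ n - 1) → ZMod 2) : ℚ) = r.weight} : ℚ) = r.mult

end GenKasami

end

/-!
For fixed `(α, β)` the phase is a quadratic form over `𝔽₂` plus a linear form. The radical of its
polar form is the kernel of `x ↦ α x ^ 2 ^ m + β x ^ 2 ^ k + (β x) ^ 2 ^ (n - k)`. A power of the
Frobenius turns this map into a polynomial of degree two in the Frobenius of exponent `m + k`, so
the radical of a nonzero pair has dimension at most `2 * gcd (n, m + k)`. The polar form is
alternating over the subfield of order `2 ^ d`, so this dimension is `2 * j` with `d ∣ j`, and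
`S ∈ {0, ± 2 ^ (m + j)}`. The first two moments over `γ` then give the value distribution for fixed
`(α, β)` in terms of `j` alone.

It remains to count the pairs `(α, β)` for each `j`. The total number of pairs is one equation, and
the number of pairs whose radical contains a given `y ≠ 0`, summed over `y`, is a second one. If
`d' = 2 * d`, a third is the moment of `S(α, β, 0)`, whose sign is determined by `j`: the phase with
`γ = 0` is invariant under multiplication by the roots of unity of order `2 ^ d + 1`, so
`S(α, β, 0) ≡ 1` modulo `2 ^ d + 1`.

A word that vanishes identically has a polar form with full radical, which the dimension bound
excludes for `(α, β) ≠ 0`. Hence the words are distinct, and they exhaust the code because the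
parity-check polynomial has degree at most `5 * m`.
-/

noncomputable section

namespace GenKasami

section SignSums

/-- The nontrivial additive character `a ↦ (-1) ^ a` of the prime field. -/
def signChar : AddChar (ZMod 2) ℤ :=
  AddChar.zmodChar 2 (ζ := -1) (by norm_num)

theorem signChar_eq_one_iff {a : ZMod 2} : signChar a = 1 ↔ a = 0 := by
  revert a
  decide

theorem signChar_mul_self (a : ZMod 2) : signChar a * signChar a = 1 := by
  revert a
  decide

theorem sum_signChar_addMonoidHom {W : Type*} [AddGroup W] [Fintype W] (f : W →+ ZMod 2)
    [Decidable (f = 0)] : ∑ w, signChar (f w) = if f = 0 then (Fintype.card W : ℤ) else 0 := by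
  classical
  have h : signChar.compAddMonoidHom f = 0 ↔ f = 0 := by
    simp [DFunLike.ext_iff, signChar_eq_one_iff]
  simpa only [AddChar.compAddMonoidHom_apply, h] using (signChar.compAddMonoidHom f).sum_eq_ite

theorem sum_sum_signChar {W V : Type*} [AddCommGroup W] [Fintype W] [AddCommGroup V] [Fintype V]
    (B : W →+ V →+ ZMod 2) :
    ∑ w, ∑ v, signChar (B w v) = (Nat.card B.ker * Fintype.card V : ℤ) := by
  classical
  simp only [sum_signChar_addMonoidHom, ← AddMonoidHom.mem_ker, ← Finset.sum_filter,
    Finset.sum_const, nsmul_eq_mul, Nat.card_eq_fintype_card, Fintype.card_subtype]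

theorem natCard_ker_mul_card {W V : Type*} [AddCommGroup W] [Fintype W] [AddCommGroup V]
    [Fintype V] (B : W →+ V →+ ZMod 2) :
    Nat.card B.ker * Fintype.card V = Nat.card B.flip.ker * Fintype.card W := by
  have h := (sum_sum_signChar B).symm.trans (Finset.sum_comm.trans (sum_sum_signChar B.flip))
  exact_mod_cast h

/-- The sum of the signs `(-1) ^ Q x`; the exponential sums are the values of this functional at
the phases. -/
def signSum {V : Type*} [Fintype V] (Q : V → ZMod 2) : ℤ :=
  ∑ x, signChar (Q x)

variable {V W : Type*} [AddCommGroup V] [Module (ZMod 2) V]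
  [AddCommGroup W] [Module (ZMod 2) W] [Fintype W]

theorem sum_signChar_pairing {P : W →ₗ[ZMod 2] V →ₗ[ZMod 2] ZMod 2} (hP : P.SeparatingRight)
    [DecidableEq V] (x : V) :
    ∑ w, signChar (P w x) = if x = 0 then (Fintype.card W : ℤ) else 0 := by
  classical
  have h : (P.flip x).toAddMonoidHom = 0 ↔ x = 0 := by
    refine ⟨fun h => hP x fun w => DFunLike.congr_fun h w, ?_⟩
    rintro rfl
    ext
    simp
  have h_sum := sum_signChar_addMonoidHom (P.flip x).toAddMonoidHom
  simp only [h] at h_sum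
  exact h_sum

variable [Fintype V]

theorem sum_signSum_add_pairing {P : W →ₗ[ZMod 2] V →ₗ[ZMod 2] ZMod 2}
    (hP : P.SeparatingRight) (Q : V → ZMod 2) :
    ∑ w, signSum (fun x => Q x + P w x) = Fintype.card W * signChar (Q 0) := by
  classical
  simp only [signSum, AddChar.map_add_eq_mul]
  rw [Finset.sum_comm]
  simp only [← Finset.mul_sum, sum_signChar_pairing hP]
  simp [mul_comm]

theorem sum_signSum_add_pairing_sq {P : W →ₗ[ZMod 2] V →ₗ[ZMod 2] ZMod 2}
    (hP : P.SeparatingRight) (Q : V → ZMod 2) :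
    ∑ w, signSum (fun x => Q x + P w x) ^ 2 = (Fintype.card W * Fintype.card V : ℤ) := by
  classical
  have h (w : W) : signSum (fun x => Q x + P w x) ^ 2 =
      ∑ x, ∑ y, signChar (Q x) * signChar (Q y) * signChar (P w (x - y)) := by
    rw [pow_two, signSum, Finset.sum_mul_sum]
    refine Finset.sum_congr rfl fun x _ => Finset.sum_congr rfl fun y _ => ?_
    rw [map_sub, CharTwo.sub_eq_add]
    simp only [AddChar.map_add_eq_mul]
    ring
  simp only [h]
  rw [Finset.sum_comm]
  simp only [Finset.sum_comm (s := Finset.univ (α := W)), ← Finset.mul_sum,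
    sum_signChar_pairing hP, sub_eq_zero]
  simp [signChar_mul_self, mul_comm]

/-- Shifting one variable of the squared sum by the other makes the phase linear in that variable,
so that only the radical of the polar form contributes. -/
theorem signSum_sq {B : LinearMap.BilinForm (ZMod 2) V} {Q : V → ZMod 2}
    (hQ : ∀ x y, Q (x + y) = Q x + Q y + B x y) [Fintype (LinearMap.ker B)] :
    signSum Q ^ 2 = Fintype.card V * ∑ z : LinearMap.ker B, signChar (Q z) := by
  classical
  have hB (z : V) : (B z).toAddMonoidHom = 0 ↔ z ∈ LinearMap.ker B := by
    rw [LinearMap.mem_ker, LinearMap.ext_iff, DFunLike.ext_iff]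
    rfl
  calc signSum Q ^ 2 = ∑ x, ∑ z, signChar (Q x) * signChar (Q (z + x)) := by
        rw [pow_two, signSum, Finset.sum_mul_sum]
        exact Finset.sum_congr rfl fun x _ =>
          (Equiv.sum_comp (Equiv.addRight x) fun y => signChar (Q x) * signChar (Q y)).symm
    _ = ∑ z, signChar (Q z) * ∑ x, signChar (B z x) := by
        rw [Finset.sum_comm]
        simp only [Finset.mul_sum, hQ, AddChar.map_add_eq_mul]
        refine Finset.sum_congr rfl fun z _ => Finset.sum_congr rfl fun x _ => ?_
        linear_combination signChar (Q z) * signChar (B z x) * signChar_mul_self (Q x)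
    _ = ∑ z, if z ∈ LinearMap.ker B then Fintype.card V * signChar (Q z) else 0 := by
        refine Finset.sum_congr rfl fun z _ => ?_
        have h := sum_signChar_addMonoidHom (B z).toAddMonoidHom
        simp only [hB] at h
        exact (congrArg _ h).trans (by split_ifs <;> ring)
    _ = _ := by
        rw [← Finset.sum_filter, Finset.mul_sum]
        exact Finset.sum_subtype _ (by simp) _

/-- On the radical of its polar form `Q` is additive. -/
theorem signSum_sq_eq_or_eq_zero {B : LinearMap.BilinForm (ZMod 2) V} {Q : V → ZMod 2}
    (hQ : ∀ x y, Q (x + y) = Q x + Q y + B x y) :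
    signSum Q ^ 2 = Fintype.card V * Nat.card (LinearMap.ker B) ∨ signSum Q = 0 := by
  classical
  have h_sq := signSum_sq hQ
  let Q_ker : LinearMap.ker B →+ ZMod 2 := AddMonoidHom.mk' (fun z => Q z) fun z w => by
    simp [hQ, LinearMap.mem_ker.1 z.2]
  have h_sum := sum_signChar_addMonoidHom Q_ker
  by_cases h : Q_ker = 0
  · left
    rw [if_pos h] at h_sum
    rw [h_sq, Nat.card_eq_fintype_card]
    exact congrArg _ h_sum
  · right
    rw [if_neg h] at h_sum
    exact pow_eq_zero_iff two_ne_zero |>.1 (h_sq.trans (mul_eq_zero_of_right _ h_sum))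

end SignSums

section ThreeValues

variable {G : Type*} [Fintype G] {f : G → ℤ} {s a b : ℤ}

theorem two_mul_card_eq_of_three_values (hs : s ≠ 0) (hf : ∀ g, f g = s ∨ f g = -s ∨ f g = 0)
    (h_sum : ∑ g, f g = s * a) (h_sq : ∑ g, f g ^ 2 = s ^ 2 * b) (ε : ℤˣ) :
    2 * (Nat.card {g // f g = ε * s} : ℤ) = b + ε * a := by
  classical
  have h (g : G) : f g * (f g + ε * s) = if f g = ε * s then 2 * s ^ 2 else 0 := by
    rcases Int.units_eq_one_or ε with rfl | rfl <;> rcases hf g with h | h | h <;>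
      simp [h, hs, neg_eq_self, self_eq_neg, eq_comm (a := (0 : ℤ))] <;> ring
  have h_count : ∑ g, f g * (f g + ε * s) = s ^ 2 * (2 * (Nat.card {g // f g = ε * s} : ℤ)) := by
    simp only [h, ← Finset.sum_filter, Finset.sum_const, nsmul_eq_mul, Nat.card_eq_fintype_card,
      Fintype.card_subtype]
    ring
  have h_moments : ∑ g, f g * (f g + ε * s) = s ^ 2 * (b + ε * a) := by
    simp only [mul_add, ← pow_two, Finset.sum_add_distrib, ← Finset.sum_mul, h_sum, h_sq]
    ring
  exact mul_left_cancel₀ (pow_ne_zero 2 hs) (h_count.symm.trans h_moments)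

theorem card_eq_zero_of_three_values (hs : s ≠ 0) (hf : ∀ g, f g = s ∨ f g = -s ∨ f g = 0)
    (h_sq : ∑ g, f g ^ 2 = s ^ 2 * b) :
    (Nat.card {g // f g = 0} : ℤ) = Fintype.card G - b := by
  classical
  have h (g : G) : s ^ 2 - f g ^ 2 = if f g = 0 then s ^ 2 else 0 := by
    rcases hf g with h | h | h <;> simp [h, hs]
  have h_count : ∑ g, (s ^ 2 - f g ^ 2) = s ^ 2 * (Nat.card {g // f g = 0} : ℤ) := by
    simp only [h, ← Finset.sum_filter, Finset.sum_const, nsmul_eq_mul, Nat.card_eq_fintype_card,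
      Fintype.card_subtype]
    ring
  have h_moments : ∑ g, (s ^ 2 - f g ^ 2) = s ^ 2 * (Fintype.card G - b) := by
    simp only [Finset.sum_sub_distrib, Finset.sum_const, h_sq, Finset.card_univ, nsmul_eq_mul]
    ring
  exact mul_left_cancel₀ (pow_ne_zero 2 hs) (h_count.symm.trans h_moments)

end ThreeValues

section Isotropic

variable {k K V : Type*} [Field k] [Field K] [AddCommGroup V] [Module k V] [Module K V]
  {B : LinearMap.BilinForm k V}

/-- In a perfect field of characteristic two every scalar is a square `e ^ 2`, and
`B (e ^ 2 • x) x = B (e • x) (e • x)`. -/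
theorem smul_self_eq_zero_of_isAlt [CharP K 2] [PerfectRing K 2]
    (h_adj : ∀ (c : K) x y, B (c • x) y = B x (c • y)) (h_alt : B.IsAlt) (c : K) (x : V) :
    B (c • x) x = 0 := by
  obtain ⟨e, rfl⟩ := surjective_frobenius K 2 c
  rw [frobenius_def, pow_two, mul_smul, h_adj, h_alt]

variable [Algebra k K] [IsScalarTower k K V] [FiniteDimensional k V]

/-- A maximal totally isotropic `K`-subspace is its own orthogonal complement. -/
theorem exists_orthogonal_restrictScalars_eq_self
    (h_adj : ∀ (c : K) x y, B (c • x) y = B x (c • y)) (h_alt : ∀ (c : K) x, B (c • x) x = 0) :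
    ∃ W : Submodule K V, B.orthogonal (W.restrictScalars k) = W.restrictScalars k := by
  have : FiniteDimensional K V := Module.Finite.of_restrictScalars_finite k K V
  have h_refl : B.IsRefl := LinearMap.BilinForm.IsAlt.isRefl fun x => by simpa using h_alt 1 x
  obtain ⟨W, hW, h_max⟩ := WellFounded.has_min (wellFounded_gt (α := Submodule K V))
    {W | ∀ x ∈ W, ∀ y ∈ W, B x y = 0} ⟨⊥, by simp⟩
  refine ⟨W, le_antisymm (fun y hy => ?_) fun y hy w hw => hW w hw y hy⟩
  replace hy : ∀ w ∈ W, B w y = 0 := hy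
  suffices h : W ⊔ K ∙ y ∈ {W : Submodule K V | ∀ x ∈ W, ∀ y ∈ W, B x y = 0} by
    have h_eq : W = W ⊔ K ∙ y := eq_of_le_of_not_lt le_sup_left (h_max _ h)
    exact h_eq ▸ Submodule.mem_sup_right (Submodule.mem_span_singleton_self y)
  intro u hu v hv
  obtain ⟨w, hw, _, hu', rfl⟩ := Submodule.mem_sup.1 hu
  obtain ⟨w', hw', _, hv', rfl⟩ := Submodule.mem_sup.1 hv
  obtain ⟨c, rfl⟩ := Submodule.mem_span_singleton.1 hu'
  obtain ⟨c', rfl⟩ := Submodule.mem_span_singleton.1 hv'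
  have h_left : B w (c' • y) = 0 := by rw [← h_adj, hy _ (W.smul_mem c' hw)]
  have h_right : B (c • y) w' = 0 := by rw [h_adj, h_refl _ _ (hy _ (W.smul_mem c hw'))]
  have h_line : B (c • y) (c' • y) = 0 := by rw [← h_adj, smul_smul, h_alt]
  simp only [map_add, LinearMap.add_apply, hW w hw w' hw', h_left, h_right, h_line, add_zero]

theorem exists_finrank_add_finrank_ker_eq (h_adj : ∀ (c : K) x y, B (c • x) y = B x (c • y))
    (h_alt : ∀ (c : K) x, B (c • x) x = 0) :
    ∃ r, Module.finrank k V + Module.finrank k (LinearMap.ker B) =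
      2 * (Module.finrank k K * r) := by
  obtain ⟨W, hW⟩ := exists_orthogonal_restrictScalars_eq_self h_adj h_alt
  have h_ker : LinearMap.ker B ≤ W.restrictScalars k := by
    rw [← hW]
    have h_refl : B.IsRefl := LinearMap.BilinForm.IsAlt.isRefl fun x => by simpa using h_alt 1 x
    exact fun y hy w _ => h_refl _ _ (by rw [LinearMap.mem_ker.1 hy, LinearMap.zero_apply])
  have h_rank := LinearMap.BilinForm.finrank_add_finrank_orthogonal' (B := B)
    (W.restrictScalars k)
  rw [hW, inf_eq_right.2 h_ker] at h_rank
  have h_tower : Module.finrank k K * Module.finrank K W =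
      Module.finrank k (W.restrictScalars k) := Module.finrank_mul_finrank k K W
  exact ⟨Module.finrank K W, by lia⟩

end Isotropic

section TwistedPolynomial

universe v

theorem rank_le_rank_range_add_one {K : Type*} {V V' : Type v} [DivisionRing K]
    [AddCommGroup V] [Module K V] [AddCommGroup V'] [Module K V'] {f : V →ₗ[K] V'} {v : V}
    (hf : LinearMap.ker f ≤ K ∙ v) :
    Module.rank K V ≤ Module.rank K (LinearMap.range f) + 1 := by
  rw [← LinearMap.rank_range_add_rank_ker f]
  exact add_le_add_right ((rank_submodule_le_one_iff' _).2 ⟨v, hf⟩) _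

variable {K L : Type*} [Field K] [Field L] [Algebra K L]

/-- Summation by parts: for a root `y`, the coefficients `a i * σ^[i] y` have sum zero. -/
theorem exists_sum_mul_iterate_sub_eq_zero {σ : L →+* L} {r : ℕ} {a : ℕ → L} {y : L}
    (ha : a (r + 1) ≠ 0) (hy : y ≠ 0)
    (hy_root : ∑ i ∈ Finset.range (r + 2), a i * σ^[i] y = 0) :
    ∃ b : ℕ → L, b r ≠ 0 ∧ ∀ x, ∑ i ∈ Finset.range (r + 2), a i * σ^[i] x = 0 →
      ∑ i ∈ Finset.range (r + 1), b i * σ^[i] (σ (x / y) - x / y) = 0 := by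
  refine ⟨fun j => ∑ i ∈ Finset.range (j + 1), a i * σ^[i] y, ?_, fun x hx => ?_⟩
  · intro (h : ∑ i ∈ Finset.range (r + 1), a i * σ^[i] y = 0)
    rw [Finset.sum_range_succ, h, zero_add] at hy_root
    exact mul_ne_zero ha (by simpa [← RingHom.coe_pow] using hy) hy_root
  · have h_parts := Finset.sum_range_by_parts (fun i => σ^[i] (x / y))
      (fun i => a i * σ^[i] y) (r + 2)
    have h_left : ∑ i ∈ Finset.range (r + 2), σ^[i] (x / y) • (a i * σ^[i] y) = 0 := by
      rw [← hx]
      refine Finset.sum_congr rfl fun i _ => ?_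
      rw [smul_eq_mul, mul_left_comm, ← iterate_map_mul, div_mul_cancel₀ x hy]
    rw [h_left, hy_root, smul_zero, zero_sub, zero_eq_neg] at h_parts
    rw [← h_parts]
    refine Finset.sum_congr rfl fun i _ => ?_
    rw [iterate_map_sub, ← Function.iterate_succ_apply, smul_eq_mul, mul_comm]

/-- Dividing by a nonzero root `y` and applying `σ - 1` lowers the order of the equation by one and
kills only the multiples of `y`. -/
theorem rank_le_of_sum_mul_iterate_eq_zero (σ : L →ₐ[K] L)
    (hσ : ∀ x, σ x = x → x ∈ Set.range (algebraMap K L)) {r : ℕ} {a : ℕ → L} (ha : a r ≠ 0)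
    (S : Submodule K L) (hS : ∀ x ∈ S, ∑ i ∈ Finset.range (r + 1), a i * σ^[i] x = 0) :
    Module.rank K S ≤ r := by
  induction r generalizing a S with
  | zero =>
    have h_bot : S = ⊥ := S.eq_bot_iff.2 fun x hx => by simpa [ha] using hS x hx
    simp [h_bot]
  | succ r ih =>
    rcases eq_or_ne S ⊥ with rfl | h_bot
    · simp
    obtain ⟨y, hy, hy0⟩ := S.exists_mem_ne_zero_of_ne_bot h_bot
    obtain ⟨b, hb, h_lower⟩ :=
      exists_sum_mul_iterate_sub_eq_zero (σ := (σ : L →+* L)) ha hy0 (hS y hy)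
    let f : S →ₗ[K] L := (σ.toLinearMap - 1) ∘ₗ LinearMap.mulRight K y⁻¹ ∘ₗ S.subtype
    have hf (x : S) : f x = σ (x / y) - x / y := by simp [f, div_eq_mul_inv]
    have h_range : Module.rank K (LinearMap.range f) ≤ r := by
      refine ih hb _ ?_
      rintro _ ⟨x, rfl⟩
      rw [hf]
      exact h_lower x (hS x x.2)
    have h_ker : LinearMap.ker f ≤ K ∙ (⟨y, hy⟩ : S) := by
      intro x hx
      obtain ⟨c, hc⟩ := hσ _ (sub_eq_zero.1 ((hf x).symm.trans hx))
      refine Submodule.mem_span_singleton.2 ⟨c, Subtype.ext ?_⟩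
      simp [Algebra.smul_def, hc, div_mul_cancel₀ _ hy0]
    exact_mod_cast (rank_le_rank_range_add_one h_ker).trans (add_le_add_left h_range 1)

end TwistedPolynomial

section Subfields

variable {F : Type*} [Field F] [Finite F] [Algebra (ZMod 2) F]

/-- The automorphism `x ↦ x ^ 2 ^ a`, kept as a power of the Frobenius automorphism so that its
inverse and its fixed field are available. -/
def frobPow (F : Type*) [Field F] [Finite F] [Algebra (ZMod 2) F] (a : ℕ) : Gal(F/ZMod 2) :=
  FiniteField.frobeniusAlgEquivOfAlgebraic (ZMod 2) F ^ a

theorem frobPow_apply (a : ℕ) (x : F) : frobPow F a x = x ^ 2 ^ a := by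
  rw [frobPow, AlgEquiv.coe_pow, FiniteField.coe_frobeniusAlgEquivOfAlgebraic_iterate, ZMod.card]

theorem frobPow_add_apply (a b : ℕ) (x : F) :
    frobPow F (a + b) x = frobPow F a (frobPow F b x) := by
  simp only [frobPow, pow_add, AlgEquiv.mul_apply]

theorem frobPow_comm (a b : ℕ) (x : F) :
    frobPow F a (frobPow F b x) = frobPow F b (frobPow F a x) := by
  rw [← frobPow_add_apply, add_comm, frobPow_add_apply]

theorem frobPow_finrank (x : F) : frobPow F (Module.finrank (ZMod 2) F) x = x := by
  rw [frobPow, ← FiniteField.orderOf_frobeniusAlgEquivOfAlgebraic, pow_orderOf_eq_one,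
    AlgEquiv.one_apply]

theorem mem_subfieldPow {a : ℕ} {x : F} : x ∈ subfieldPow F a ↔ frobPow F a x = x := by
  rw [frobPow_apply]
  rfl

theorem mem_subfieldPow_gcd {a b : ℕ} {x : F} (ha : x ∈ subfieldPow F a)
    (hb : x ∈ subfieldPow F b) : x ∈ subfieldPow F (a.gcd b) := by
  simp only [mem_subfieldPow, frobPow, AlgEquiv.coe_pow] at *
  exact Function.IsPeriodicPt.gcd ha hb

theorem subfieldPow_le {a b : ℕ} (h : a ∣ b) : subfieldPow F a ≤ subfieldPow F b := by
  intro x hx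
  simp only [mem_subfieldPow, frobPow, AlgEquiv.coe_pow] at *
  exact Function.IsPeriodicPt.trans_dvd hx h

theorem fixedField_zpowers_frobPow (a : ℕ) :
    IntermediateField.fixedField (Subgroup.zpowers (frobPow F a)) = subfieldPow F a := by
  ext x
  rw [IntermediateField.mem_fixedField_iff, mem_subfieldPow]
  refine ⟨fun h => h _ (Subgroup.mem_zpowers _), fun h f hf => ?_⟩
  have h_stab : Subgroup.zpowers (frobPow F a) ≤ MulAction.stabilizer Gal(F/ZMod 2) x :=
    Subgroup.zpowers_le.2 h
  exact h_stab hf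

theorem finrank_subfieldPow (a : ℕ) :
    Module.finrank (ZMod 2) (subfieldPow F a) = (Module.finrank (ZMod 2) F).gcd a := by
  have h_top : Module.finrank (subfieldPow F a) F =
      Module.finrank (ZMod 2) F / (Module.finrank (ZMod 2) F).gcd a := by
    rw [← fixedField_zpowers_frobPow, IntermediateField.finrank_fixedField_eq_card,
      Nat.card_zpowers, frobPow, orderOf_pow, FiniteField.orderOf_frobeniusAlgEquivOfAlgebraic]
  have h_tower := Module.finrank_mul_finrank (ZMod 2) (subfieldPow F a) F
  have h_pos : 0 < Module.finrank (subfieldPow F a) F := Module.finrank_pos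
  have h_div := Nat.div_mul_cancel (Nat.gcd_dvd_left (Module.finrank (ZMod 2) F) a)
  rw [← h_top, mul_comm] at h_div
  exact Nat.eq_of_mul_eq_mul_right h_pos (h_tower.trans h_div.symm)

theorem natCard_subfieldPow (a : ℕ) :
    Nat.card (subfieldPow F a) = 2 ^ (Module.finrank (ZMod 2) F).gcd a := by
  rw [Module.natCard_eq_pow_finrank (K := ZMod 2), Nat.card_zmod, finrank_subfieldPow]

omit [Finite F] in
theorem finrank_eq_of_card [Fintype F] {n : ℕ} (hF : Fintype.card F = 2 ^ n) :
    Module.finrank (ZMod 2) F = n := by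
  have h := Module.natCard_eq_pow_finrank (K := ZMod 2) (V := F)
  rw [Nat.card_zmod, Nat.card_eq_fintype_card, hF] at h
  exact (Nat.pow_right_injective le_rfl h).symm

theorem trace_frobPow (a : ℕ) (x : F) :
    Algebra.trace (ZMod 2) F (frobPow F a x) = Algebra.trace (ZMod 2) F x :=
  Algebra.trace_eq_of_algEquiv _ x

end Subfields

section RelativeTrace

variable {F : Type*} [Field F] [Finite F] [Algebra (ZMod 2) F] {m : ℕ}

theorem frobPow_frobPow_half (hm : Module.finrank (ZMod 2) F = 2 * m) (x : F) :
    frobPow F m (frobPow F m x) = x := by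
  rw [← frobPow_add_apply, ← two_mul, ← hm, frobPow_finrank]

theorem natCard_subfieldPow_half (hm : Module.finrank (ZMod 2) F = 2 * m) :
    Nat.card (subfieldPow F m) = 2 ^ m := by
  rw [natCard_subfieldPow, hm, Nat.gcd_mul_left_left]

theorem coe_trace_subfieldPow_half (hm : Module.finrank (ZMod 2) F = 2 * m) (z : F) :
    (Algebra.trace (subfieldPow F m) F z : F) = z + frobPow F m z := by
  have h_tower := Module.finrank_mul_finrank (ZMod 2) (subfieldPow F m) F
  have h_pos : 0 < Module.finrank (ZMod 2) F := Module.finrank_pos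
  rw [finrank_subfieldPow, hm, Nat.gcd_mul_left_left] at h_tower
  have h_two : Module.finrank (subfieldPow F m) F = 2 := by nlinarith
  have h := FiniteField.algebraMap_trace_eq_sum_pow (subfieldPow F m) F z
  rw [h_two, natCard_subfieldPow_half hm, Finset.sum_range_succ, Finset.sum_range_one, pow_zero,
    pow_one, pow_one, ← frobPow_apply] at h
  exact h

end RelativeTrace

section PolarForm

variable {F : Type*} [Field F] [Finite F] [Algebra (ZMod 2) F] {m : ℕ}

theorem trace_mul_frobPow_eq_symm (k : ℕ) (x y : F) :
    Algebra.trace (ZMod 2) F (x * frobPow F k y) =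
      Algebra.trace (ZMod 2) F ((frobPow F k).symm x * y) := by
  rw [← trace_frobPow k ((frobPow F k).symm x * y), map_mul (frobPow F k),
    AlgEquiv.apply_symm_apply]

/-- The linear map representing the polarization of the phase through the trace form. -/
def polarMap (k : ℕ) (α : subfieldPow F m) (β : F) : F →ₗ[ZMod 2] F :=
  LinearMap.mulLeft (ZMod 2) (α : F) ∘ₗ (frobPow F m).toLinearMap +
    LinearMap.mulLeft (ZMod 2) β ∘ₗ (frobPow F k).toLinearMap +
    (frobPow F k).symm.toLinearMap ∘ₗ LinearMap.mulLeft (ZMod 2) β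

theorem polarMap_apply (k : ℕ) (α : subfieldPow F m) (β x : F) :
    polarMap k α β x = α * frobPow F m x + β * frobPow F k x + (frobPow F k).symm (β * x) :=
  rfl

/-- The bilinear form polarizing the phase. -/
def polarForm (k : ℕ) (α : subfieldPow F m) (β : F) : LinearMap.BilinForm (ZMod 2) F :=
  (Algebra.traceForm (ZMod 2) F).compLeft (polarMap k α β)

theorem polarForm_apply (k : ℕ) (α : subfieldPow F m) (β x y : F) :
    polarForm k α β x y = Algebra.trace (ZMod 2) F (polarMap k α β x * y) :=
  rfl

theorem polarForm_eq_trace_add_trace (k : ℕ) (α : subfieldPow F m) (β x y : F) :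
    polarForm k α β x y =
      Algebra.trace (ZMod 2) (subfieldPow F m)
        (α * Algebra.trace (subfieldPow F m) F (frobPow F m x * y)) +
      Algebra.trace (ZMod 2) F (β * (frobPow F k x * y + x * frobPow F k y)) := by
  have h_alpha : Algebra.trace (ZMod 2) (subfieldPow F m)
      (α * Algebra.trace (subfieldPow F m) F (frobPow F m x * y)) =
      Algebra.trace (ZMod 2) F (α * (frobPow F m x * y)) := by
    rw [← smul_eq_mul, ← map_smul, Algebra.trace_trace]
    rfl
  have h_beta := trace_mul_frobPow_eq_symm k (β * x) y
  rw [polarForm_apply, polarMap_apply, h_alpha]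
  simp only [add_mul, mul_add, map_add, ← mul_assoc, ← h_beta]
  exact add_assoc _ _ _

/-- The radical of the polar form. -/
def radical (k : ℕ) (α : subfieldPow F m) (β : F) : Submodule (ZMod 2) F :=
  LinearMap.ker (polarMap k α β)

theorem mem_radical {k : ℕ} {α : subfieldPow F m} {β x : F} :
    x ∈ radical k α β ↔ polarMap k α β x = 0 :=
  Iff.rfl

theorem traceForm_separatingRight :
    (Algebra.traceForm (ZMod 2) F).SeparatingRight :=
  (traceForm_nondegenerate (ZMod 2) F).2

theorem ker_polarForm (k : ℕ) (α : subfieldPow F m) (β : F) :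
    LinearMap.ker (polarForm k α β) = radical k α β := by
  ext x
  rw [mem_radical, LinearMap.mem_ker]
  refine ⟨fun h => (traceForm_nondegenerate (ZMod 2) F).1 _ fun y => LinearMap.congr_fun h y,
    fun h => ?_⟩
  ext y
  rw [polarForm_apply, h, zero_mul, map_zero, LinearMap.zero_apply]

end PolarForm

section Phase

variable {F : Type*} [Field F] [Fintype F] [Algebra (ZMod 2) F] {n m k : ℕ}
  (hn : n = 2 * m) (hF : Fintype.card F = 2 ^ n) (α : subfieldPow F m) (β γ : F)

theorem coe_powElt (x : F) : (powElt hn hF x : F) = frobPow F m x * x := by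
  rw [frobPow_apply, ← pow_succ]
  rfl

theorem powElt_add (x y : F) :
    powElt hn hF (x + y) = powElt hn hF x + powElt hn hF y +
      Algebra.trace (subfieldPow F m) F (frobPow F m x * y) := by
  have hm : Module.finrank (ZMod 2) F = 2 * m := (finrank_eq_of_card hF).trans hn
  apply Subtype.ext
  push_cast
  rw [coe_trace_subfieldPow_half hm, map_mul, frobPow_frobPow_half hm]
  simp only [coe_powElt, map_add]
  ring

theorem phase_zero : phase hn hF k α β γ 0 = 0 := by
  have h : powElt hn hF (0 : F) = 0 := Subtype.ext (by simp [coe_powElt])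
  simp [phase, h]

theorem phase_add (x y : F) :
    phase hn hF k α β γ (x + y) =
      phase hn hF k α β γ x + phase hn hF k α β γ y + polarForm k α β x y := by
  have h_pow : (x + y) ^ (2 ^ k + 1) = x ^ (2 ^ k + 1) + y ^ (2 ^ k + 1) +
      (frobPow F k x * y + x * frobPow F k y) := by
    simp only [pow_succ _ (2 ^ k), ← frobPow_apply, map_add]
    ring
  rw [polarForm_eq_trace_add_trace]
  simp only [phase, powElt_add, h_pow, mul_add, map_add]
  abel

end Phase

section Radical

variable {F : Type*} [Field F] [Finite F] [Algebra (ZMod 2) F] {m k : ℕ}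

theorem polarMap_mul {c : F} (hc : frobPow F k c = frobPow F m c)
    (hc' : (frobPow F k).symm c = frobPow F m c) (α : subfieldPow F m) (β x : F) :
    polarMap k α β (c * x) = frobPow F m c * polarMap k α β x := by
  simp only [polarMap_apply, map_mul, hc, hc']
  ring

theorem radical_zero : radical (F := F) (m := m) k 0 0 = ⊤ := by
  refine eq_top_iff.2 fun x _ => ?_
  simp [mem_radical, polarMap_apply]

theorem polarForm_smul_of_mem_subfieldPow_gcd (α : subfieldPow F m) (β : F)
    (c : subfieldPow F (m.gcd k)) (x y : F) :
    polarForm k α β (c • x) y = polarForm k α β x (c • y) := by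
  have hm := mem_subfieldPow.1 (subfieldPow_le (m.gcd_dvd_left k) c.2)
  have hk := mem_subfieldPow.1 (subfieldPow_le (m.gcd_dvd_right k) c.2)
  have hk' : (frobPow F k).symm (c : F) = c := by rw [AlgEquiv.symm_apply_eq, hk]
  rw [polarForm_apply, polarForm_apply, Algebra.smul_def, Algebra.smul_def,
    IntermediateField.algebraMap_apply, polarMap_mul (hk.trans hm.symm) (hk'.trans hm.symm), hm,
    mul_left_comm, mul_assoc]

theorem frobPow_eq_of_mem_subfieldPow_add (hm : Module.finrank (ZMod 2) F = 2 * m) {c : F}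
    (hc : c ∈ subfieldPow F (m + k)) :
    frobPow F k c = frobPow F m c ∧ (frobPow F k).symm c = frobPow F m c := by
  rw [mem_subfieldPow] at hc
  constructor
  · rw [← frobPow_frobPow_half hm (frobPow F k c), ← frobPow_add_apply m k, hc]
  · rw [AlgEquiv.symm_apply_eq, ← frobPow_add_apply, add_comm, hc]

/-- The radical is stable under the subfield on which `x ↦ x ^ 2 ^ k`, its inverse and
`x ↦ x ^ 2 ^ m` coincide. -/
def radicalOver (hm : Module.finrank (ZMod 2) F = 2 * m) (k : ℕ) (α : subfieldPow F m) (β : F) :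
    Submodule (subfieldPow F (m + k)) F where
  __ := (radical k α β).toAddSubmonoid
  smul_mem' := by
    rintro c x (hx : polarMap k α β x = 0)
    obtain ⟨hc, hc'⟩ := frobPow_eq_of_mem_subfieldPow_add hm c.2
    change polarMap k α β (c * x) = 0
    rw [polarMap_mul hc hc', hx, mul_zero]

theorem mem_radicalOver {hm : Module.finrank (ZMod 2) F = 2 * m} {α : subfieldPow F m} {β x : F} :
    x ∈ radicalOver hm k α β ↔ x ∈ radical k α β :=
  Iff.rfl

/-- The image of `polarMap k α β x` under `σ ^ k`, written through `τ = σ ^ (m + k)` alone: since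
`σ ^ (2 * m) = 1`, one has `σ ^ (2 * k) = τ ^ 2`. -/
theorem frobPow_polarMap (hm : Module.finrank (ZMod 2) F = 2 * m) (α : subfieldPow F m) (β x : F) :
    frobPow F k (polarMap k α β x) = β * x + frobPow F k α * frobPow F (m + k) x +
      frobPow F k β * frobPow F (m + k) (frobPow F (m + k) x) := by
  have h_sq : frobPow F (m + k) (frobPow F (m + k) x) = frobPow F k (frobPow F k x) := by
    rw [frobPow_add_apply, frobPow_comm k, frobPow_add_apply, frobPow_frobPow_half hm]
  rw [polarMap_apply, h_sq, add_comm m k, frobPow_add_apply]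
  simp only [map_add, map_mul, AlgEquiv.apply_symm_apply]
  ring

theorem radical_eq_bot {α : subfieldPow F m} (hα : α ≠ 0) : radical k α 0 = ⊥ := by
  refine (Submodule.eq_bot_iff _).2 fun x hx => ?_
  have h : (α : F) * frobPow F m x = 0 := by simpa [mem_radical, polarMap_apply] using hx
  simpa [hα] using h

theorem rank_radicalOver_le (hm : Module.finrank (ZMod 2) F = 2 * m) (α : subfieldPow F m) {β : F}
    (hβ : β ≠ 0) : Module.rank (subfieldPow F (m + k)) (radicalOver hm k α β) ≤ 2 := by
  let τ : F →ₐ[subfieldPow F (m + k)] F :=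
    { (frobPow F (m + k) : F →+* F) with commutes' := fun c => mem_subfieldPow.1 c.2 }
  have hτ (x : F) : τ x = frobPow F (m + k) x := rfl
  have h_fixed (x : F) (hx : τ x = x) :
      x ∈ Set.range (algebraMap (subfieldPow F (m + k)) F) := ⟨⟨x, mem_subfieldPow.2 hx⟩, rfl⟩
  let a (i : ℕ) : F := if i = 0 then β else if i = 1 then frobPow F k α else frobPow F k β
  have ha : a 2 ≠ 0 := by simpa [a] using hβ
  refine mod_cast rank_le_of_sum_mul_iterate_eq_zero τ h_fixed ha _ fun x hx => ?_
  have h := frobPow_polarMap (k := k) hm α β x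
  rw [mem_radical.1 (mem_radicalOver.1 hx), map_zero] at h
  simpa [Finset.sum_range_succ, a, hτ] using h.symm

theorem finrank_radical_le (hm : Module.finrank (ZMod 2) F = 2 * m) {α : subfieldPow F m} {β : F}
    (h : α ≠ 0 ∨ β ≠ 0) :
    Module.finrank (ZMod 2) (radical k α β) ≤ 2 * (2 * m).gcd (m + k) := by
  rcases eq_or_ne β 0 with rfl | hβ
  · rw [radical_eq_bot (h.resolve_right fun h => h rfl), finrank_bot]
    exact Nat.zero_le _
  have h_tower := Module.finrank_mul_finrank (ZMod 2) (subfieldPow F (m + k))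
    (radicalOver hm k α β)
  rw [finrank_subfieldPow, hm] at h_tower
  calc Module.finrank (ZMod 2) (radical k α β)
      = (2 * m).gcd (m + k) * Module.finrank (subfieldPow F (m + k)) (radicalOver hm k α β) :=
        h_tower.symm
    _ ≤ (2 * m).gcd (m + k) * 2 :=
        Nat.mul_le_mul_left _ (Module.finrank_le_of_rank_le (rank_radicalOver_le hm α hβ))
    _ = _ := mul_comm _ _

theorem polarForm_isAlt (hm : Module.finrank (ZMod 2) F = 2 * m) (α : subfieldPow F m) (β : F) :
    (polarForm k α β).IsAlt := by
  intro x
  have h_char : CharP F 2 := charP_of_injective_algebraMap (algebraMap (ZMod 2) F).injective 2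
  have h_trace : Algebra.trace (subfieldPow F m) F (frobPow F m x * x) = 0 := by
    apply Subtype.ext
    rw [coe_trace_subfieldPow_half hm, map_mul, frobPow_frobPow_half hm, mul_comm x,
      CharTwo.add_self_eq_zero, ZeroMemClass.coe_zero]
  rw [polarForm_eq_trace_add_trace, h_trace, mul_comm x, CharTwo.add_self_eq_zero]
  simp only [mul_zero, map_zero, add_zero]

theorem two_mul_gcd_dvd_finrank_radical (hm : Module.finrank (ZMod 2) F = 2 * m)
    (α : subfieldPow F m) (β : F) :
    2 * m.gcd k ∣ Module.finrank (ZMod 2) (radical k α β) := by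
  have h_char : CharP (subfieldPow F (m.gcd k)) 2 :=
    charP_of_injective_algebraMap (algebraMap (ZMod 2) _).injective 2
  obtain ⟨r, hr⟩ := exists_finrank_add_finrank_ker_eq
    (polarForm_smul_of_mem_subfieldPow_gcd α β)
    (smul_self_eq_zero_of_isAlt (polarForm_smul_of_mem_subfieldPow_gcd (k := k) α β)
      (polarForm_isAlt hm α β))
  have h_dvd : m.gcd k ∣ 2 * m := (m.gcd_dvd_left k).mul_left 2
  rw [ker_polarForm, finrank_subfieldPow, hm, Nat.gcd_eq_right h_dvd, ← mul_assoc] at hr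
  exact (Nat.dvd_add_right (mul_dvd_mul_left 2 (m.gcd_dvd_left k))).1 ⟨r, hr⟩

end Radical

section RadicalMoment

variable {F : Type*} [Field F] [Finite F] [Algebra (ZMod 2) F] {m k : ℕ}

theorem div_mem_subfieldPow_iff {y z : F} (hy : y ≠ 0) (a : ℕ) :
    z / y ∈ subfieldPow F a ↔ frobPow F a y * z + y * frobPow F a z = 0 := by
  have h_char : CharP F 2 := charP_of_injective_algebraMap (algebraMap (ZMod 2) F).injective 2
  have hy' : frobPow F a y ≠ 0 := by simpa using hy
  rw [mem_subfieldPow, map_div₀, div_eq_div_iff hy' hy, CharTwo.add_eq_zero, mul_comm z,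
    mul_comm _ y, eq_comm]

theorem trace_mul_right_eq_zero_iff {K : Type*} [Field K] [Finite K] [Algebra (ZMod 2) K] {z : K} :
    (∀ x, Algebra.trace (ZMod 2) K (x * z) = 0) ↔ z = 0 :=
  ⟨traceForm_separatingRight z, by rintro rfl; simp⟩

theorem forall_polarForm_eq_zero_iff (hm : Module.finrank (ZMod 2) F = 2 * m) {y : F} (hy : y ≠ 0)
    (z : F) : (∀ (α : subfieldPow F m) (β : F), polarForm k α β y z = 0) ↔
      z / y ∈ subfieldPow F (m.gcd k) := by
  have h_split : (∀ (α : subfieldPow F m) (β : F), polarForm k α β y z = 0) ↔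
      z / y ∈ subfieldPow F m ∧ z / y ∈ subfieldPow F k := by
    have h_trace : frobPow F m y * z + y * frobPow F m z =
        (Algebra.trace (subfieldPow F m) F (frobPow F m y * z) : F) := by
      rw [coe_trace_subfieldPow_half hm, map_mul, frobPow_frobPow_half hm]
    rw [div_mem_subfieldPow_iff hy, div_mem_subfieldPow_iff hy, h_trace, ZeroMemClass.coe_eq_zero,
      ← trace_mul_right_eq_zero_iff, ← trace_mul_right_eq_zero_iff]
    simp only [polarForm_eq_trace_add_trace]
    refine ⟨fun h => ⟨fun α => by simpa using h α 0, fun β => by simpa using h 0 β⟩, ?_⟩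
    rintro ⟨h_left, h_right⟩ α β
    rw [h_left, h_right, add_zero]
  rw [h_split]
  exact ⟨fun h => mem_subfieldPow_gcd h.1 h.2, fun h =>
    ⟨subfieldPow_le (m.gcd_dvd_left k) h, subfieldPow_le (m.gcd_dvd_right k) h⟩⟩

/-- The polar form at a fixed first argument, paired with the coefficients: its two kernels are
computed by `mem_radical` and by `forall_polarForm_eq_zero_iff`. -/
def polarPairing (k : ℕ) (y : F) : subfieldPow F m × F →+ F →+ ZMod 2 :=
  AddMonoidHom.mk' (fun p => (polarForm k p.1 p.2 y).toAddMonoidHom) fun p q => by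
    ext z
    change polarForm k (p.1 + q.1) (p.2 + q.2) y z =
      polarForm k p.1 p.2 y z + polarForm k q.1 q.2 y z
    simp only [polarForm_eq_trace_add_trace, add_mul, map_add]
    abel

theorem mem_ker_polarPairing {y : F} {p : subfieldPow F m × F} :
    p ∈ (polarPairing k y).ker ↔ y ∈ radical k p.1 p.2 := by
  rw [← ker_polarForm, LinearMap.mem_ker, AddMonoidHom.mem_ker, LinearMap.ext_iff,
    AddMonoidHom.ext_iff]
  rfl

theorem natCard_ker_flip_polarPairing (hm : Module.finrank (ZMod 2) F = 2 * m) {y : F}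
    (hy : y ≠ 0) :
    Nat.card (polarPairing (m := m) k y).flip.ker = 2 ^ m.gcd k := by
  have h_mem (z : F) : z ∈ (polarPairing (m := m) k y).flip.ker ↔
      z / y ∈ subfieldPow F (m.gcd k) := by
    rw [← forall_polarForm_eq_zero_iff hm hy, AddMonoidHom.mem_ker, AddMonoidHom.ext_iff,
      Prod.forall]
    rfl
  have h_dvd : m.gcd k ∣ 2 * m := (m.gcd_dvd_left k).mul_left 2
  rw [← Nat.gcd_eq_right h_dvd, ← hm, ← natCard_subfieldPow]
  exact Nat.card_congr ((Equiv.divRight₀ y hy).subtypeEquiv h_mem)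

theorem natCard_pairs_of_mem_radical (hm : Module.finrank (ZMod 2) F = 2 * m) {y : F} (hy : y ≠ 0) :
    Nat.card {p : subfieldPow F m × F // y ∈ radical k p.1 p.2} = 2 ^ (m + m.gcd k) := by
  have := Fintype.ofFinite F
  have := Fintype.ofFinite (subfieldPow F m)
  have h := natCard_ker_mul_card (polarPairing (m := m) k y)
  rw [natCard_ker_flip_polarPairing hm hy, ← Nat.card_eq_fintype_card, ← Nat.card_eq_fintype_card,
    Nat.card_prod, natCard_subfieldPow_half hm, ← mul_assoc] at h
  have h_pos : 0 < Nat.card F := Nat.card_pos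
  rw [← Nat.card_congr (Equiv.subtypeEquivRight fun p => mem_ker_polarPairing (k := k) (y := y)),
    pow_add, mul_comm]
  exact Nat.eq_of_mul_eq_mul_right h_pos h

end RadicalMoment

section PairCount

variable {F : Type*} [Field F] [Finite F] [Algebra (ZMod 2) F] {m k : ℕ}

theorem sum_natCard_comm {X Y : Type*} [Fintype X] [Fintype Y] (r : X → Y → Prop) :
    ∑ x, Nat.card {y // r x y} = ∑ y, Nat.card {x // r x y} := by
  classical
  simp only [Nat.card_eq_fintype_card, Fintype.card_subtype]
  exact Finset.sum_card_bipartiteAbove_eq_sum_card_bipartiteBelow r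

theorem natCard_pairs (hm : Module.finrank (ZMod 2) F = 2 * m) :
    Nat.card (subfieldPow F m × F) = 2 ^ (3 * m) := by
  rw [Nat.card_prod, natCard_subfieldPow_half hm, Module.natCard_eq_pow_finrank (K := ZMod 2),
    Nat.card_zmod, hm]
  ring

theorem sum_natCard_radical [Fintype (subfieldPow F m × F)]
    (hm : Module.finrank (ZMod 2) F = 2 * m) :
    ∑ p : subfieldPow F m × F, Nat.card (radical k p.1 p.2) =
      2 ^ (3 * m) + (2 ^ (2 * m) - 1) * 2 ^ (m + m.gcd k) := by
  classical
  have := Fintype.ofFinite F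
  have h_card : Fintype.card F = 2 ^ (2 * m) := by
    rw [← Nat.card_eq_fintype_card, Module.natCard_eq_pow_finrank (K := ZMod 2), Nat.card_zmod, hm]
  have h (y : F) : Nat.card {p : subfieldPow F m × F // y ∈ radical k p.1 p.2} =
      if y = 0 then 2 ^ (3 * m) else 2 ^ (m + m.gcd k) := by
    split_ifs with hy
    · rw [hy, ← natCard_pairs hm]
      exact Nat.card_congr (Equiv.subtypeUnivEquiv fun p => zero_mem _)
    · exact natCard_pairs_of_mem_radical hm hy
  calc ∑ p : subfieldPow F m × F, Nat.card (radical k p.1 p.2)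
      = ∑ y, Nat.card {p : subfieldPow F m × F // y ∈ radical k p.1 p.2} := sum_natCard_comm _
    _ = ∑ y : F, if y = 0 then 2 ^ (3 * m) else 2 ^ (m + m.gcd k) :=
      Finset.sum_congr rfl fun y _ => h y
    _ = 2 ^ (3 * m) + (2 ^ (2 * m) - 1) * 2 ^ (m + m.gcd k) := by
      rw [← Finset.add_sum_erase _ _ (Finset.mem_univ 0), if_pos rfl,
        Finset.sum_congr rfl fun y hy => if_neg (Finset.ne_of_mem_erase hy), Finset.sum_const,
        Finset.card_erase_of_mem (Finset.mem_univ _), Finset.card_univ, h_card, smul_eq_mul]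

/-- The number of pairs `(α, β)` whose radical has dimension `2 * j`. -/
def pairCount (F : Type*) [Field F] [Finite F] [Algebra (ZMod 2) F] (m k j : ℕ) : ℕ :=
  Nat.card {p : subfieldPow F m × F // Module.finrank (ZMod 2) (radical k p.1 p.2) = 2 * j}

theorem sum_comp_finrank_radical [Fintype (subfieldPow F m × F)] {J : Finset ℕ}
    (hJ : ∀ (α : subfieldPow F m) (β : F),
      ∃ j ∈ J, Module.finrank (ZMod 2) (radical k α β) = 2 * j) (f : ℕ → ℤ) :
    ∑ p : subfieldPow F m × F, f (Module.finrank (ZMod 2) (radical k p.1 p.2)) =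
      ∑ j ∈ J, pairCount F m k j * f (2 * j) := by
  classical
  have h_maps (p : subfieldPow F m × F) (_ : p ∈ Finset.univ) :
      Module.finrank (ZMod 2) (radical k p.1 p.2) ∈ J.image (2 * ·) := by
    obtain ⟨j, hj, h⟩ := hJ p.1 p.2
    exact Finset.mem_image.2 ⟨j, hj, h.symm⟩
  rw [← Finset.sum_fiberwise_of_maps_to' h_maps, Finset.sum_image (by simp)]
  refine Finset.sum_congr rfl fun j _ => ?_
  rw [Finset.sum_const, nsmul_eq_mul, pairCount, Nat.card_eq_fintype_card, Fintype.card_subtype]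

theorem sum_pairCount (hm : Module.finrank (ZMod 2) F = 2 * m) {J : Finset ℕ}
    (hJ : ∀ (α : subfieldPow F m) (β : F),
      ∃ j ∈ J, Module.finrank (ZMod 2) (radical k α β) = 2 * j) :
    ∑ j ∈ J, (pairCount F m k j : ℤ) = 2 ^ (3 * m) := by
  have := Fintype.ofFinite (subfieldPow F m × F)
  have h := sum_comp_finrank_radical hJ fun _ => 1
  rw [Finset.sum_const, Finset.card_univ, ← Nat.card_eq_fintype_card, natCard_pairs hm] at h
  simpa using h.symm

theorem sum_pairCount_mul_two_pow (hm : Module.finrank (ZMod 2) F = 2 * m) {J : Finset ℕ}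
    (hJ : ∀ (α : subfieldPow F m) (β : F),
      ∃ j ∈ J, Module.finrank (ZMod 2) (radical k α β) = 2 * j) :
    ∑ j ∈ J, (pairCount F m k j * 2 ^ (2 * j) : ℤ) =
      2 ^ (3 * m) + (2 ^ (2 * m) - 1) * 2 ^ (m + m.gcd k) := by
  have := Fintype.ofFinite (subfieldPow F m × F)
  have h_card (p : subfieldPow F m × F) : (Nat.card (radical k p.1 p.2) : ℤ) =
      2 ^ Module.finrank (ZMod 2) (radical k p.1 p.2) := by
    rw [Module.natCard_eq_pow_finrank (K := ZMod 2), Nat.card_zmod, Nat.cast_pow, Nat.cast_ofNat]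
  have h := congrArg (Nat.cast : ℕ → ℤ) (sum_natCard_radical (k := k) hm)
  push_cast [Nat.one_le_two_pow] at h
  rw [← sum_comp_finrank_radical hJ fun r => 2 ^ r, ← h]
  exact Finset.sum_congr rfl fun p _ => (h_card p).symm

theorem pairCount_self (hm : Module.finrank (ZMod 2) F = 2 * m)
    (h_lt : (2 * m).gcd (m + k) < m) : pairCount F m k m = 1 := by
  have h_iff (p : subfieldPow F m × F) :
      Module.finrank (ZMod 2) (radical k p.1 p.2) = 2 * m ↔ p = 0 := by
    refine ⟨fun h => ?_, ?_⟩
    · by_contra hp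
      have h_ne : p.1 ≠ 0 ∨ p.2 ≠ 0 := not_and_or.1 (mt Prod.mk_eq_zero.2 hp)
      have h_le := finrank_radical_le (k := k) hm h_ne
      lia
    · rintro rfl
      rw [Prod.fst_zero, Prod.snd_zero, radical_zero, finrank_top, hm]
  rw [pairCount, Nat.card_congr (Equiv.subtypeEquivRight h_iff), Nat.card_unique]

end PairCount

section ExpSum

variable {F : Type*} [Field F] [Fintype F] [Algebra (ZMod 2) F] {n m k j : ℕ}
  (hn : n = 2 * m) (hF : Fintype.card F = 2 ^ n)

theorem expSum_eq_signSum (α : subfieldPow F m) (β γ : F) :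
    expSum hn hF k α β γ = signSum (phase hn hF k α β γ) :=
  rfl

theorem expSum_eq_signSum_add_traceForm (α : subfieldPow F m) (β γ : F) :
    expSum hn hF k α β γ =
      signSum fun x => phase hn hF k α β 0 x + Algebra.traceForm (ZMod 2) F γ x := by
  rw [expSum_eq_signSum]
  congr 1
  ext x
  rw [phase, phase, zero_mul, add_zero, map_add, add_assoc, Algebra.traceForm_apply]

theorem sum_expSum (α : subfieldPow F m) (β : F) :
    ∑ γ, expSum hn hF k α β γ = 2 ^ n := by
  simp only [expSum_eq_signSum_add_traceForm]
  rw [sum_signSum_add_pairing traceForm_separatingRight, phase_zero, AddChar.map_zero_eq_one,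
    mul_one, hF, Nat.cast_pow, Nat.cast_ofNat]

theorem sum_expSum_sq (α : subfieldPow F m) (β : F) :
    ∑ γ, expSum hn hF k α β γ ^ 2 = 2 ^ (2 * n) := by
  simp only [expSum_eq_signSum_add_traceForm]
  rw [sum_signSum_add_pairing_sq traceForm_separatingRight, hF, Nat.cast_pow, Nat.cast_ofNat,
    ← pow_add, ← two_mul]

theorem expSum_eq_of_finrank_radical {α : subfieldPow F m} {β : F}
    (hj : Module.finrank (ZMod 2) (radical k α β) = 2 * j) (γ : F) :
    expSum hn hF k α β γ = 2 ^ (m + j) ∨ expSum hn hF k α β γ = -2 ^ (m + j) ∨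
      expSum hn hF k α β γ = 0 := by
  subst hn
  have h := signSum_sq_eq_or_eq_zero (phase_add (k := k) rfl hF α β γ)
  rw [ker_polarForm, Module.natCard_eq_pow_finrank (K := ZMod 2), Nat.card_zmod, hF, hj,
    ← expSum_eq_signSum] at h
  rw [← or_assoc, ← sq_eq_sq_iff_eq_or_eq_neg]
  refine h.imp_left fun h => h.trans ?_
  push_cast
  ring

theorem two_mul_natCard_expSum_eq {α : subfieldPow F m} {β : F}
    (hj : Module.finrank (ZMod 2) (radical k α β) = 2 * j) (hjm : j ≤ m) (ε : ℤˣ) :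
    2 * (Nat.card {γ // expSum hn hF k α β γ = ε * 2 ^ (m + j)} : ℤ) =
      2 ^ (2 * (m - j)) + ε * 2 ^ (m - j) := by
  obtain ⟨i, rfl⟩ := Nat.exists_eq_add_of_le hjm
  rw [Nat.add_sub_cancel_left]
  refine two_mul_card_eq_of_three_values (by positivity)
    (expSum_eq_of_finrank_radical hn hF hj) ?_ ?_ ε
  · rw [sum_expSum, hn]
    ring
  · rw [sum_expSum_sq, hn]
    ring

theorem natCard_expSum_eq_zero {α : subfieldPow F m} {β : F}
    (hj : Module.finrank (ZMod 2) (radical k α β) = 2 * j) (hjm : j ≤ m) :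
    (Nat.card {γ // expSum hn hF k α β γ = 0} : ℤ) = 2 ^ (2 * m) - 2 ^ (2 * m - 2 * j) := by
  obtain ⟨i, rfl⟩ := Nat.exists_eq_add_of_le hjm
  have h_card : (Fintype.card F : ℤ) = 2 ^ (2 * (j + i)) := by
    rw [hF, hn]
    push_cast
    rfl
  rw [← Nat.mul_sub, Nat.add_sub_cancel_left, ← h_card]
  refine card_eq_zero_of_three_values (s := 2 ^ (j + i + j)) (by positivity)
    (expSum_eq_of_finrank_radical hn hF hj) ?_
  rw [sum_expSum_sq, hn]
  ring

end ExpSum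

section Triples

theorem natCard_triples_eq_sum {A B C : Type*} [Fintype (A × B)] [Finite C] (P : A → B → C → Prop) :
    (Nat.card {t : A × B × C // P t.1 t.2.1 t.2.2} : ℤ) =
      ∑ p : A × B, (Nat.card {c // P p.1 p.2 c} : ℤ) := by
  rw [← Nat.cast_sum, ← Nat.card_sigma]
  congr 1
  exact Nat.card_congr
    { toFun := fun t => ⟨(t.1.1, t.1.2.1), t.1.2.2, t.2⟩
      invFun := fun t => ⟨(t.1.1, t.1.2, t.2.1), t.2.2⟩
      left_inv := fun _ => rfl
      right_inv := fun _ => rfl }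

variable {F : Type*} [Field F] [Fintype F] [Algebra (ZMod 2) F] {n m k j : ℕ}
  (hn : n = 2 * m) (hF : Fintype.card F = 2 ^ n)

include hn hF in
theorem exists_finrank_radical_eq_two_mul (α : subfieldPow F m) (β : F) :
    ∃ j ≤ m, Module.finrank (ZMod 2) (radical k α β) = 2 * j := by
  have hm : Module.finrank (ZMod 2) F = 2 * m := (finrank_eq_of_card hF).trans hn
  obtain ⟨j, hj⟩ := (dvd_mul_right 2 _).trans (two_mul_gcd_dvd_finrank_radical (k := k) hm α β)
  have h_le := (Submodule.finrank_le (radical k α β)).trans_eq hm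
  exact ⟨j, by lia, hj⟩

theorem two_mul_natCard_triples (hjm : j ≤ m) (ε : ℤˣ) :
    2 * (Nat.card {t : subfieldPow F m × F × F //
      expSum hn hF k t.1 t.2.1 t.2.2 = ε * 2 ^ (m + j)} : ℤ) =
      (pairCount F m k j * (2 ^ (2 * (m - j)) + ε * 2 ^ (m - j)) : ℤ) := by
  classical
  have := Fintype.ofFinite (subfieldPow F m)
  have h (p : subfieldPow F m × F) :
      2 * (Nat.card {γ // expSum hn hF k p.1 p.2 γ = ε * 2 ^ (m + j)} : ℤ) =
        if Module.finrank (ZMod 2) (radical k p.1 p.2) = 2 * j then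
          (2 ^ (2 * (m - j)) + ε * 2 ^ (m - j) : ℤ) else 0 := by
    split_ifs with hp
    · exact two_mul_natCard_expSum_eq hn hF hp hjm ε
    obtain ⟨i, -, hi⟩ := exists_finrank_radical_eq_two_mul (k := k) hn hF p.1 p.2
    have h_ne : i ≠ j := by lia
    have h_empty (γ : F) : expSum hn hF k p.1 p.2 γ ≠ ε * 2 ^ (m + j) := fun hγ => by
      have h_abs : |expSum hn hF k p.1 p.2 γ| = 2 ^ (m + j) := by
        rw [hγ, abs_mul, Int.isUnit_iff_abs_eq.1 ε.isUnit, one_mul, abs_of_nonneg (by positivity)]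
      rcases expSum_eq_of_finrank_radical hn hF hi γ with h | h | h
      · simp [h, h_ne] at h_abs
      · simp [h, h_ne] at h_abs
      · rw [h, abs_zero] at h_abs
        exact pow_ne_zero _ two_ne_zero h_abs.symm
    have : IsEmpty {γ // expSum hn hF k p.1 p.2 γ = ε * 2 ^ (m + j)} :=
      ⟨fun γ => h_empty γ γ.2⟩
    rw [Nat.card_of_isEmpty, Nat.cast_zero, mul_zero]
  rw [natCard_triples_eq_sum fun α β γ => expSum hn hF k α β γ = ε * 2 ^ (m + j),
    Finset.mul_sum, Finset.sum_congr rfl fun p _ => h p, ← Finset.sum_filter, Finset.sum_const,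
    nsmul_eq_mul, pairCount, Nat.card_eq_fintype_card, Fintype.card_subtype]

theorem natCard_triples_zero {J : Finset ℕ}
    (hJ : ∀ (α : subfieldPow F m) (β : F),
      ∃ j ∈ J, Module.finrank (ZMod 2) (radical k α β) = 2 * j) :
    (Nat.card {t : subfieldPow F m × F × F // expSum hn hF k t.1 t.2.1 t.2.2 = 0} : ℤ) =
      ∑ j ∈ J, (pairCount F m k j * (2 ^ (2 * m) - 2 ^ (2 * m - 2 * j)) : ℤ) := by
  have := Fintype.ofFinite (subfieldPow F m)
  rw [natCard_triples_eq_sum fun α β γ => expSum hn hF k α β γ = 0,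
    ← sum_comp_finrank_radical hJ fun r => 2 ^ (2 * m) - 2 ^ (2 * m - r)]
  refine Finset.sum_congr rfl fun p _ => ?_
  obtain ⟨j, hjm, hj⟩ := exists_finrank_radical_eq_two_mul (k := k) hn hF p.1 p.2
  rw [natCard_expSum_eq_zero hn hF hj hjm, hj]

end Triples

section Congruence

theorem natCard_ker_dvd_sum {G H : Type*} [Group G] [Fintype G] [Group H] (φ : G →* H)
    {f : G → ℤ} (hf : Function.FactorsThrough f φ) : (Nat.card φ.ker : ℤ) ∣ ∑ g, f g := by
  classical
  have h_maps (g : G) (_ : g ∈ Finset.univ) : φ g ∈ Finset.univ.image φ :=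
    Finset.mem_image_of_mem φ (Finset.mem_univ g)
  rw [← Finset.sum_fiberwise_of_maps_to h_maps]
  refine Finset.dvd_sum fun y hy => ?_
  obtain ⟨g₀, -, rfl⟩ := Finset.mem_image.1 hy
  have h_card : (Finset.univ.filter fun g => φ g = φ g₀).card = Nat.card φ.ker := by
    rw [MonoidHom.card_fiber_eq_of_mem_range φ ⟨g₀, rfl⟩ ⟨1, map_one φ⟩,
      Nat.card_eq_fintype_card, ← Fintype.card_subtype]
    exact Fintype.card_congr (Equiv.refl _)
  rw [Finset.sum_congr rfl fun g hg => hf (Finset.mem_filter.1 hg).2, Finset.sum_const, h_card,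
    nsmul_eq_mul]
  exact dvd_mul_right _ _

theorem eq_neg_one_pow_mul_pow_of_modEq {b S : ℤ} {t : ℕ} (hb : 2 ≤ b)
    (hS : S = b ^ t ∨ S = -b ^ t ∨ S = 0) (h : S ≡ 1 [ZMOD b + 1]) : S = (-1) ^ t * b ^ t := by
  have eq_one_of_modEq (c : ℤ) (hc : c ≡ 1 [ZMOD b + 1]) (hc_abs : |c| ≤ 1) : c = 1 := by
    rw [abs_le] at hc_abs
    have := Int.eq_zero_of_dvd_of_nonneg_of_lt (by linarith) (by linarith) hc.dvd
    linarith
  have h_pow : b ^ t ≡ (-1) ^ t [ZMOD b + 1] :=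
    Int.ModEq.pow t (Int.modEq_iff_dvd.2 ⟨-1, by ring⟩)
  have h_sq : (-1 : ℤ) ^ t * (-1) ^ t = 1 := by rw [← mul_pow]; simp
  obtain ⟨η, hη, rfl⟩ : ∃ η : ℤ, |η| ≤ 1 ∧ S = η * b ^ t := by
    rcases hS with h | h | h
    · exact ⟨1, by simp, by simp [h]⟩
    · exact ⟨-1, by simp, by simp [h]⟩
    · exact ⟨0, by simp, by simp [h]⟩
  have h_one : η * (-1) ^ t = 1 :=
    eq_one_of_modEq _ ((h_pow.mul_left η).symm.trans h) (by simpa [abs_mul] using hη)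
  linear_combination b ^ t * ((-1) ^ t * h_one - η * h_sq)

variable {F : Type*} [Field F] [Fintype F] [Algebra (ZMod 2) F] {n m k : ℕ}
  (hn : n = 2 * m) (hF : Fintype.card F = 2 ^ n)

theorem phase_eq_of_pow_eq {e : ℕ} (he_m : e ∣ 2 ^ m + 1) (he_k : e ∣ 2 ^ k + 1)
    (α : subfieldPow F m) (β : F) {x y : F} (h : x ^ e = y ^ e) :
    phase hn hF k α β 0 x = phase hn hF k α β 0 y := by
  have pow_eq {s : ℕ} (hs : e ∣ s) : x ^ s = y ^ s := by
    obtain ⟨t, rfl⟩ := hs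
    rw [pow_mul, pow_mul, h]
  have h_powElt : powElt hn hF x = powElt hn hF y := Subtype.ext (pow_eq he_m)
  rw [phase, phase, h_powElt, pow_eq he_k, zero_mul, zero_mul]

theorem expSum_zero_modEq_one {e : ℕ} (he_m : e ∣ 2 ^ m + 1) (he_k : e ∣ 2 ^ k + 1)
    (α : subfieldPow F m) (β : F) : expSum hn hF k α β 0 ≡ 1 [ZMOD e] := by
  classical
  have h_units : Nat.card Fˣ = (2 ^ m + 1) * (2 ^ m - 1) := by
    rw [Nat.card_eq_fintype_card, Fintype.card_units, hF, hn, mul_comm 2 m, pow_mul,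
      ← Nat.sq_sub_sq, one_pow]
  have h_ker : Nat.card (powMonoidHom e : Fˣ →* Fˣ).ker = e := by
    rw [IsCyclic.card_powMonoidHom_ker, h_units, Nat.gcd_eq_right (he_m.mul_right _)]
  have h_factors : Function.FactorsThrough (fun u : Fˣ => signChar (phase hn hF k α β 0 u))
      (powMonoidHom e : Fˣ →* Fˣ) := fun u v huv =>
    congrArg signChar (phase_eq_of_pow_eq hn hF he_m he_k α β (by exact_mod_cast huv))
  have h_sum : expSum hn hF k α β 0 = 1 + ∑ u : Fˣ, signChar (phase hn hF k α β 0 u) := by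
    rw [expSum_eq_signSum, signSum, Fintype.sum_eq_add_sum_subtype_ne _ (0 : F), phase_zero,
      AddChar.map_zero_eq_one, ← unitsEquivNeZero.sum_comp]
    rfl
  have h_dvd := natCard_ker_dvd_sum _ h_factors
  rw [h_ker] at h_dvd
  rw [h_sum]
  exact (Int.modEq_iff_dvd.2 (by simpa using h_dvd)).symm

theorem expSum_zero_eq_of_odd {a b d i : ℕ} (hd : 0 < d) (hm : m = d * a) (hk : k = d * b)
    (ha : Odd a) (hb : Odd b) {α : subfieldPow F m} {β : F}
    (hi : Module.finrank (ZMod 2) (radical k α β) = 2 * (d * i)) :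
    expSum hn hF k α β 0 = -(-1) ^ i * 2 ^ (m + d * i) := by
  have dvd_of_odd {t : ℕ} (ht : Odd t) : 2 ^ d + 1 ∣ 2 ^ (d * t) + 1 := by
    simpa only [one_pow, ← pow_mul] using ht.nat_add_dvd_pow_add_pow (2 ^ d) 1
  have h_mod : expSum hn hF k α β 0 ≡ 1 [ZMOD 2 ^ d + 1] := by
    exact_mod_cast expSum_zero_modEq_one hn hF (hm ▸ dvd_of_odd ha) (hk ▸ dvd_of_odd hb) α β
  have h_pow : (2 ^ d : ℤ) ^ (a + i) = 2 ^ (m + d * i) := by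
    rw [← pow_mul, mul_add, hm]
  have h_values := expSum_eq_of_finrank_radical hn hF hi 0
  rw [← h_pow] at h_values ⊢
  rw [eq_neg_one_pow_mul_pow_of_modEq (le_self_pow₀ one_le_two hd.ne') h_values h_mod, pow_add,
    ha.neg_one_pow, neg_one_mul]

end Congruence

section SignedMoment

variable {F : Type*} [Field F] [Fintype F] [Algebra (ZMod 2) F] {n m k : ℕ}
  (hn : n = 2 * m) (hF : Fintype.card F = 2 ^ n)

/-- The phase at `x` as an additive function of the coefficients `(α, β, γ)`. -/
def phaseHom (k : ℕ) (x : F) : subfieldPow F m × F × F →+ ZMod 2 :=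
  AddMonoidHom.mk' (fun t => phase hn hF k t.1 t.2.1 t.2.2 x) fun t u => by
    simp only [phase, Prod.fst_add, Prod.snd_add, add_mul, map_add]
    abel

theorem sum_expSum_zero [Fintype (subfieldPow F m × F)] :
    ∑ p : subfieldPow F m × F, expSum hn hF k p.1 p.2 0 = 2 ^ (3 * m) := by
  classical
  let pairHom (x : F) : subfieldPow F m × F →+ ZMod 2 :=
    (phaseHom hn hF k x).comp
      (AddMonoidHom.prodMap (AddMonoidHom.id _) (AddMonoidHom.inl F F))
  have h_zero (x : F) : pairHom x = 0 ↔ x = 0 := by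
    refine ⟨fun h => ?_, ?_⟩
    · have h_trace : ∀ β, Algebra.trace (ZMod 2) F (β * x ^ (2 ^ k + 1)) = 0 := fun β => by
        simpa [pairHom, phaseHom, phase] using DFunLike.congr_fun h (0, β)
      exact eq_zero_of_pow_eq_zero (trace_mul_right_eq_zero_iff.1 h_trace)
    · rintro rfl
      ext p
      exact phase_zero hn hF p.1 p.2 0
  have hm : Module.finrank (ZMod 2) F = 2 * m := (finrank_eq_of_card hF).trans hn
  calc ∑ p : subfieldPow F m × F, expSum hn hF k p.1 p.2 0
      = ∑ x, ∑ p, signChar (pairHom x p) := Finset.sum_comm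
    _ = ∑ x : F, if x = 0 then (Fintype.card (subfieldPow F m × F) : ℤ) else 0 := by
      simp only [sum_signChar_addMonoidHom, h_zero]
    _ = 2 ^ (3 * m) := by
      rw [Finset.sum_ite_eq' Finset.univ, if_pos (Finset.mem_univ _),
        ← Nat.card_eq_fintype_card, natCard_pairs hm, Nat.cast_pow, Nat.cast_ofNat]

include hn hF in
theorem sum_pairCount_signed {J : Finset ℕ}
    (hJ : ∀ (α : subfieldPow F m) (β : F),
      ∃ j ∈ J, Module.finrank (ZMod 2) (radical k α β) = 2 * j)
    (h_odd_m : Odd (m / m.gcd k)) (h_odd_k : Odd (k / m.gcd k)) :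
    ∑ j ∈ J, (pairCount F m k j * (-(-1) ^ (j / m.gcd k) * 2 ^ (m + j)) : ℤ) = 2 ^ (3 * m) := by
  have := Fintype.ofFinite (subfieldPow F m)
  have hm : Module.finrank (ZMod 2) F = 2 * m := (finrank_eq_of_card hF).trans hn
  have h_pos : 0 < m.gcd k := Nat.pos_of_ne_zero fun h => by simp [h] at h_odd_m
  have h_expSum (p : subfieldPow F m × F) : expSum hn hF k p.1 p.2 0 =
      -(-1) ^ (Module.finrank (ZMod 2) (radical k p.1 p.2) / 2 / m.gcd k) *
        2 ^ (m + Module.finrank (ZMod 2) (radical k p.1 p.2) / 2) := by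
    obtain ⟨i, hi⟩ := two_mul_gcd_dvd_finrank_radical (k := k) hm p.1 p.2
    rw [mul_assoc] at hi
    rw [hi, Nat.mul_div_cancel_left _ two_pos, Nat.mul_div_cancel_left _ h_pos]
    exact expSum_zero_eq_of_odd hn hF h_pos (Nat.mul_div_cancel' (m.gcd_dvd_left k)).symm
      (Nat.mul_div_cancel' (m.gcd_dvd_right k)).symm h_odd_m h_odd_k hi
  rw [← sum_expSum_zero (k := k) hn hF, Finset.sum_congr rfl fun p _ => h_expSum p,
    sum_comp_finrank_radical hJ fun r => -(-1) ^ (r / 2 / m.gcd k) * 2 ^ (m + r / 2)]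
  simp only [Nat.mul_div_cancel_left _ two_pos]

end SignedMoment

section CyclicCode

variable {l : ℕ} {h h' : (ZMod 2)[X]}

theorem wordPoly_eq_degreeLTEquiv_symm (c : Fin l → ZMod 2) :
    wordPoly c = ((degreeLTEquiv (ZMod 2) l).symm c : (ZMod 2)[X]) := by
  simp only [wordPoly, C_mul_X_pow_eq_monomial]
  rfl

theorem wordPoly_injective : Function.Injective (wordPoly (l := l)) := fun c c' hc => by
  rw [wordPoly_eq_degreeLTEquiv_symm, wordPoly_eq_degreeLTEquiv_symm] at hc
  exact (degreeLTEquiv (ZMod 2) l).symm.injective (Subtype.ext hc)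

theorem degree_wordPoly_lt (c : Fin l → ZMod 2) : (wordPoly c).degree < l := by
  rw [wordPoly_eq_degreeLTEquiv_symm, ← mem_degreeLT]
  exact Subtype.prop _

theorem cyclicCode_mono (h_dvd : h ∣ h') : cyclicCode l h ≤ cyclicCode l h' :=
  fun _ hc => dvd_trans hc (mul_dvd_mul_right h_dvd _)

theorem natCard_cyclicCode_le (hl : 0 < l) (hh : h ≠ 0) :
    Nat.card (cyclicCode l h) ≤ 2 ^ h.natDegree := by
  choose q hq using fun c : cyclicCode l h => (c.2 : X ^ l - 1 ∣ h * wordPoly c.1)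
  have hq_mem (c) : q c ∈ degreeLT (ZMod 2) h.natDegree := by
    rw [mem_degreeLT, ← degree_eq_natDegree hh]
    refine lt_of_add_lt_add_left (a := (l : WithBot ℕ)) ?_
    have h_deg := congrArg degree (hq c)
    rw [degree_mul, degree_mul, ← C_1, degree_X_pow_sub_C hl] at h_deg
    rw [← h_deg, add_comm]
    exact WithBot.add_lt_add_right (degree_ne_bot.2 hh) (degree_wordPoly_lt _)
  have hq_inj : Function.Injective fun c => (⟨q c, hq_mem c⟩ : degreeLT (ZMod 2) h.natDegree) := by
    intro c c' hcc
    have h_eq : h * wordPoly c.1 = h * wordPoly c'.1 := by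
      rw [hq c, hq c', show q c = q c' from congrArg Subtype.val hcc]
    exact Subtype.ext (wordPoly_injective (mul_left_cancel₀ hh h_eq))
  have : Finite (degreeLT (ZMod 2) h.natDegree) :=
    Finite.of_equiv _ (degreeLTEquiv (ZMod 2) h.natDegree).symm.toEquiv
  refine (Nat.card_le_card_of_injective _ hq_inj).trans_eq ?_
  rw [Nat.card_congr (degreeLTEquiv (ZMod 2) h.natDegree).toEquiv, Nat.card_fun, Nat.card_zmod,
    Nat.card_fin]

variable {L : Type*} [Field L] [Algebra (ZMod 2) L]

/-- The word with entries `f (b * a ^ i)`, as an element of `𝔽₂[X] / (X ^ l - 1)`. -/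
def functionalWord (f : L →ₗ[ZMod 2] ZMod 2) (a : L) (l : ℕ) : L →ₗ[ZMod 2]
    AdjoinRoot (X ^ l - 1 : (ZMod 2)[X]) :=
  ∑ i ∈ Finset.range l, (LinearMap.toSpanSingleton (ZMod 2) _ (AdjoinRoot.root _ ^ i)).comp
    (f.comp (LinearMap.mulRight (ZMod 2) (a ^ i)))

theorem functionalWord_apply (f : L →ₗ[ZMod 2] ZMod 2) (a b : L) :
    functionalWord f a l b = ∑ i ∈ Finset.range l, f (b * a ^ i) • AdjoinRoot.root _ ^ i := by
  simp [functionalWord]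

-- Multiplication by the root shifts a word cyclically, and so does replacing `b` by `a⁻¹ * b`.
theorem root_mul_functionalWord (f : L →ₗ[ZMod 2] ZMod 2) {a : L} (ha : a ≠ 0) (hal : a ^ l = 1)
    (b : L) :
    AdjoinRoot.root _ * functionalWord f a l b = functionalWord f a l (a⁻¹ * b) := by
  have h_root : AdjoinRoot.root (X ^ l - 1 : (ZMod 2)[X]) ^ l = 1 := by
    have := AdjoinRoot.eval₂_root (X ^ l - 1 : (ZMod 2)[X])
    rwa [eval₂_sub, eval₂_X_pow, eval₂_one, sub_eq_zero] at this
  have h_shift (i : ℕ) : a⁻¹ * b * a ^ (i + 1) = b * a ^ i := by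
    rw [pow_succ', mul_comm a⁻¹, mul_assoc, inv_mul_cancel_left₀ ha]
  rw [← sub_eq_zero, functionalWord_apply, functionalWord_apply, Finset.mul_sum,
    ← Finset.sum_sub_distrib]
  have h_telescope := Finset.sum_range_sub (fun i : ℕ => f (a⁻¹ * b * a ^ i) •
    AdjoinRoot.root (X ^ l - 1 : (ZMod 2)[X]) ^ i) l
  rw [hal, h_root, pow_zero, pow_zero, sub_self] at h_telescope
  rw [← h_telescope]
  refine Finset.sum_congr rfl fun i _ => ?_
  rw [h_shift, mul_smul_comm, pow_succ']

theorem aeval_root_mul_functionalWord (f : L →ₗ[ZMod 2] ZMod 2) {a : L} (ha : a ≠ 0)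
    (hal : a ^ l = 1) (p : (ZMod 2)[X]) (b : L) :
    aeval (AdjoinRoot.root _) p * functionalWord f a l b =
      functionalWord f a l (aeval a⁻¹ p * b) := by
  induction p using Polynomial.induction_on generalizing b with
  | C r => simp only [aeval_C, ← Algebra.smul_def, map_smul]
  | add p q hp hq => simp only [map_add, add_mul, hp, hq]
  | monomial i r ih =>
    rw [pow_succ, ← mul_assoc, map_mul _ _ X, map_mul _ _ X, aeval_X, aeval_X, mul_assoc,
      root_mul_functionalWord f ha hal, ih, mul_assoc]

theorem mem_cyclicCode_of_aeval_inv_eq_zero (f : L →ₗ[ZMod 2] ZMod 2) {a : L} (ha : a ≠ 0)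
    (hal : a ^ l = 1) (hh : aeval a⁻¹ h = 0) :
    (fun i : Fin l => f (a ^ (i : ℕ))) ∈ cyclicCode l h := by
  change X ^ l - 1 ∣ h * wordPoly _
  have h_word : AdjoinRoot.mk (X ^ l - 1) (wordPoly fun i : Fin l => f (a ^ (i : ℕ))) =
      functionalWord f a l 1 := by
    rw [functionalWord_apply, ← Fin.sum_univ_eq_sum_range fun i =>
      f (1 * a ^ i) • AdjoinRoot.root (X ^ l - 1 : (ZMod 2)[X]) ^ i]
    simp only [wordPoly, map_sum, map_mul, map_pow, AdjoinRoot.mk_X, AdjoinRoot.mk_C, one_mul,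
      Algebra.smul_def]
    rfl
  rw [← AdjoinRoot.mk_eq_zero, map_mul, h_word, ← AdjoinRoot.aeval_eq,
    aeval_root_mul_functionalWord f ha hal, hh, zero_mul, map_zero]

end CyclicCode

section Words

theorem sum_signChar_eq_sub_hammingNorm {l : ℕ} (w : Fin l → ZMod 2) :
    ∑ i, signChar (w i) = (l - 2 * hammingNorm w : ℤ) := by
  have h_sign : ∀ a : ZMod 2, signChar a = 1 - 2 * (if a ≠ 0 then 1 else 0) := by decide
  simp only [h_sign, Finset.sum_sub_distrib, ← Finset.mul_sum, hammingNorm, Finset.card_filter]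
  simp

variable {F : Type*} [Field F] [Fintype F] {n m k : ℕ}
  (hn : n = 2 * m) (hF : Fintype.card F = 2 ^ n) {π : F}

include hF in
theorem two_pow_sub_one_pos : 0 < 2 ^ n - 1 :=
  Nat.sub_pos_of_lt (hF ▸ Fintype.one_lt_card)

include hF in
theorem exists_pow_eq (hπ : IsPrimitiveRoot π (2 ^ n - 1)) {x : F} (hx : x ≠ 0) :
    ∃ i : Fin (2 ^ n - 1), π ^ (i : ℕ) = x := by
  have : NeZero (2 ^ n - 1) := ⟨(two_pow_sub_one_pos hF).ne'⟩
  have hx_pow : x ^ (2 ^ n - 1) = 1 := by rw [← hF, FiniteField.pow_card_sub_one_eq_one x hx]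
  obtain ⟨i, hi, rfl⟩ := hπ.eq_pow_of_pow_eq_one hx_pow
  exact ⟨⟨i, hi⟩, rfl⟩

include hF in
theorem sum_eq_add_sum_pow (hπ : IsPrimitiveRoot π (2 ^ n - 1)) (f : F → ℤ) :
    ∑ x, f x = f 0 + ∑ i : Fin (2 ^ n - 1), f (π ^ (i : ℕ)) := by
  classical
  have h_ne : π ≠ 0 := hπ.ne_zero (two_pow_sub_one_pos hF).ne'
  let powers : Fin (2 ^ n - 1) → {x : F // x ≠ 0} := fun i => ⟨π ^ (i : ℕ), pow_ne_zero _ h_ne⟩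
  have h_bij : Function.Bijective powers :=
    ⟨fun i j hij => Fin.ext (hπ.pow_inj i.2 j.2 (congrArg Subtype.val hij)), fun x =>
      (exists_pow_eq hF hπ x.2).imp fun _ hi => Subtype.ext hi⟩
  rw [Fintype.sum_eq_add_sum_subtype_ne _ 0, ← h_bij.sum_comp]

variable [Algebra (ZMod 2) F]

theorem expSum_eq_sub_hammingNorm (hπ : IsPrimitiveRoot π (2 ^ n - 1)) (α : subfieldPow F m)
    (β γ : F) :
    expSum hn hF k α β γ = 2 ^ n - 2 * hammingNorm (word hn hF k π α β γ) := by
  rw [expSum_eq_signSum, signSum, sum_eq_add_sum_pow hF hπ, phase_zero, AddChar.map_zero_eq_one]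
  change 1 + ∑ i, signChar (word hn hF k π α β γ i) = _
  rw [sum_signChar_eq_sub_hammingNorm, Nat.cast_sub Nat.one_le_two_pow]
  push_cast
  ring

/-- The word `c(α, β, γ)` as an additive function of `(α, β, γ)`. -/
def wordHom (k : ℕ) (π : F) : subfieldPow F m × F × F →+ (Fin (2 ^ n - 1) → ZMod 2) :=
  AddMonoidHom.pi fun i => phaseHom hn hF k (π ^ (i : ℕ))

theorem eq_zero_of_phase_eq_zero (h_lt : (2 * m).gcd (m + k) < m) {α : subfieldPow F m} {β γ : F}
    (h : ∀ x, phase hn hF k α β γ x = 0) : α = 0 ∧ β = 0 ∧ γ = 0 := by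
  have hm : Module.finrank (ZMod 2) F = 2 * m := (finrank_eq_of_card hF).trans hn
  have h_radical : radical k α β = ⊤ := by
    rw [← ker_polarForm, LinearMap.ker_eq_top]
    ext x y
    simpa [h] using (phase_add (k := k) hn hF α β γ x y).symm
  obtain ⟨rfl, rfl⟩ : α = 0 ∧ β = 0 := by
    by_contra h_ne
    have h_le := finrank_radical_le (k := k) hm (not_and_or.1 h_ne)
    rw [h_radical, finrank_top, hm] at h_le
    lia
  refine ⟨rfl, rfl, trace_mul_right_eq_zero_iff.1 fun x => ?_⟩
  simpa [phase, mul_comm] using h x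

theorem wordHom_injective (hπ : IsPrimitiveRoot π (2 ^ n - 1)) (h_lt : (2 * m).gcd (m + k) < m) :
    Function.Injective (wordHom hn hF k π) := by
  refine (injective_iff_map_eq_zero _).2 fun t ht => ?_
  have h_phase (x : F) : phase hn hF k t.1 t.2.1 t.2.2 x = 0 := by
    obtain rfl | hx := eq_or_ne x 0
    · exact phase_zero hn hF _ _ _
    · obtain ⟨i, rfl⟩ := exists_pow_eq hF hπ hx
      exact congrFun ht i
  obtain ⟨hα, hβ, hγ⟩ := eq_zero_of_phase_eq_zero hn hF h_lt h_phase
  exact Prod.ext hα (Prod.ext hβ hγ)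

theorem minpoly_powElt_inv (x : F) :
    minpoly (ZMod 2) (powElt hn hF x)⁻¹ = minpoly (ZMod 2) (x ^ (2 ^ m + 1))⁻¹ := by
  rw [← minpoly.algebraMap_eq (algebraMap (subfieldPow F m) F).injective, map_inv₀]
  rfl

theorem powElt_pow (x : F) (i : ℕ) : powElt hn hF (x ^ i) = powElt hn hF x ^ i :=
  Subtype.ext (pow_right_comm x i (2 ^ m + 1))

theorem word_mem_codeC2 (hπ : IsPrimitiveRoot π (2 ^ n - 1)) (α : subfieldPow F m) (β γ : F) :
    word hn hF k π α β γ ∈ codeC2 n m k π := by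
  have hπ_ne : π ≠ 0 := hπ.ne_zero (two_pow_sub_one_pos hF).ne'
  have trace_word_mem {L : Type _} [Field L] [Algebra (ZMod 2) L] (b : L) {a : L} (ha : a ≠ 0)
      (hal : a ^ (2 ^ n - 1) = 1) :
      (fun i : Fin (2 ^ n - 1) => Algebra.trace (ZMod 2) L (b * a ^ (i : ℕ))) ∈
        cyclicCode (2 ^ n - 1) (minpoly (ZMod 2) a⁻¹) :=
    mem_cyclicCode_of_aeval_inv_eq_zero ((Algebra.trace (ZMod 2) L).comp (LinearMap.mulLeft _ b)) ha
      hal (minpoly.aeval _ _)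
  have h_one := trace_word_mem γ hπ_ne hπ.pow_eq_one
  have h_two := trace_word_mem β (pow_ne_zero (2 ^ k + 1) hπ_ne)
    (by rw [pow_right_comm, hπ.pow_eq_one, one_pow])
  have h_three := trace_word_mem α (a := powElt hn hF π)
    (fun h => pow_ne_zero (2 ^ m + 1) hπ_ne (congrArg Subtype.val h))
    (by rw [← powElt_pow, hπ.pow_eq_one]; exact Subtype.ext (one_pow _))
  rw [minpoly_powElt_inv] at h_three
  rw [codeC2]
  convert add_mem (cyclicCode_mono (dvd_mul_left _ _) h_three)
    (add_mem (cyclicCode_mono ((dvd_mul_left _ _).mul_right _) h_two)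
      (cyclicCode_mono ((dvd_mul_right _ _).mul_right _) h_one)) using 1
  ext i
  simp only [word, phase, map_add, powElt_pow, pow_right_comm π, Pi.add_apply]

include hn hF in
theorem natCard_codeC2_le : Nat.card (codeC2 n m k π) ≤ Nat.card (subfieldPow F m × F × F) := by
  have hm : Module.finrank (ZMod 2) F = 2 * m := (finrank_eq_of_card hF).trans hn
  have h_ne (x : F) : minpoly (ZMod 2) x ≠ 0 := minpoly.ne_zero (Algebra.IsIntegral.isIntegral x)
  refine (natCard_cyclicCode_le (two_pow_sub_one_pos hF)
    (mul_ne_zero (mul_ne_zero (h_ne _) (h_ne _)) (h_ne _))).trans ?_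
  rw [natDegree_mul (mul_ne_zero (h_ne _) (h_ne _)) (h_ne _), natDegree_mul (h_ne _) (h_ne _),
    ← minpoly_powElt_inv hn hF, Nat.card_prod, Nat.card_prod,
    Module.natCard_eq_pow_finrank (K := ZMod 2) (V := subfieldPow F m),
    Module.natCard_eq_pow_finrank (K := ZMod 2) (V := F), Nat.card_zmod, ← pow_add, ← pow_add]
  have h_one := minpoly.natDegree_le (A := ZMod 2) π⁻¹
  have h_two := minpoly.natDegree_le (A := ZMod 2) (π ^ (2 ^ k + 1))⁻¹
  have h_three := minpoly.natDegree_le (A := ZMod 2) (powElt hn hF π)⁻¹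
  exact Nat.pow_le_pow_right two_pos (by lia)

theorem range_wordHom (hπ : IsPrimitiveRoot π (2 ^ n - 1)) (h_lt : (2 * m).gcd (m + k) < m) :
    Set.range (wordHom hn hF k π) = codeC2 n m k π := by
  refine Set.eq_of_subset_of_ncard_le ?_ ?_ (Set.toFinite _)
  · rintro _ ⟨t, rfl⟩
    exact word_mem_codeC2 hn hF hπ t.1 t.2.1 t.2.2
  · rw [← Set.image_univ, Set.ncard_image_of_injective _ (wordHom_injective hn hF hπ h_lt),
      Set.ncard_univ]
    exact natCard_codeC2_le hn hF

end Words

section Distribution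

variable {F : Type*} [Field F] [Fintype F] [Algebra (ZMod 2) F] {n m k : ℕ} {π : F}
  (hn : n = 2 * m) (hF : Fintype.card F = 2 ^ n)

theorem isDistribution_of_expSum (hπ : IsPrimitiveRoot π (2 ^ n - 1))
    (h_lt : (2 * m).gcd (m + k) < m) {t : List Row}
    (h_weight : ∀ r ∈ t, r.weight = (2 ^ n - r.value) / 2)
    (h_value : ∀ α β γ, ∃ r ∈ t, (expSum hn hF k α β γ : ℚ) = r.value)
    (h_mult : ∀ r ∈ t, (Nat.card {p : subfieldPow F m × F × F //
      (expSum hn hF k p.1 p.2.1 p.2.2 : ℚ) = r.value} : ℚ) = r.mult) :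
    IsDistribution hn hF k π t := by
  have weight_iff {r : Row} (hr : r ∈ t) (p : subfieldPow F m × F × F) :
      (expSum hn hF k p.1 p.2.1 p.2.2 : ℚ) = r.value ↔
        (hammingNorm (wordHom hn hF k π p) : ℚ) = r.weight := by
    have h_sum : (expSum hn hF k p.1 p.2.1 p.2.2 : ℚ) =
        2 ^ n - 2 * hammingNorm (wordHom hn hF k π p) :=
      mod_cast expSum_eq_sub_hammingNorm hn hF hπ p.1 p.2.1 p.2.2
    rw [h_weight r hr, h_sum]
    constructor <;> intro h <;> linarith
  have mem_iff (c : Fin (2 ^ n - 1) → ZMod 2) :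
      c ∈ Set.range (wordHom hn hF k π) ↔ c ∈ codeC2 n m k π := by
    rw [range_wordHom hn hF hπ h_lt, SetLike.mem_coe]
  refine ⟨fun α β γ => ?_, h_mult, fun c hc => ?_, fun r hr => ?_⟩
  · obtain ⟨r, hr, h⟩ := h_value α β γ
    exact ⟨r, hr, h, (weight_iff hr (α, β, γ)).1 h⟩
  · obtain ⟨p, rfl⟩ := (mem_iff c).2 hc
    obtain ⟨r, hr, h⟩ := h_value p.1 p.2.1 p.2.2
    exact ⟨r, hr, (weight_iff hr p).1 h⟩
  · let equivCode := (Equiv.ofInjective _ (wordHom_injective hn hF hπ h_lt)).trans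
      (Equiv.subtypeEquivRight mem_iff)
    rw [← h_mult r hr]
    exact congrArg _ (Nat.card_congr (equivCode.subtypeEquiv (weight_iff hr))).symm

end Distribution

section RankTable

/-- The table in which, for each `j` in the list `J`, the values `±2 ^ (m + j)` come from `N j`
pairs `(α, β)` with a radical of dimension `2 * j`. The last row is that of `(0, 0, 0)`; the other
triples `(0, 0, γ)` contribute `2 ^ (2 * m) - 1` to the multiplicity of `0`. -/
def rankTable (m : ℕ) (J : List ℕ) (N : ℕ → ℚ) : List Row :=
  J.flatMap (fun j => [1, -1].map fun ε =>
    ⟨ε * 2 ^ (m + j), (2 ^ (2 * m) - ε * 2 ^ (m + j)) / 2,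
      N j * ((2 ^ m / 2 ^ j) ^ 2 + ε * (2 ^ m / 2 ^ j)) / 2⟩) ++
  [⟨0, 2 ^ (2 * m) / 2,
      2 ^ (2 * m) - 1 + (J.map fun j => N j * (2 ^ (2 * m) - (2 ^ m / 2 ^ j) ^ 2)).sum⟩,
    ⟨2 ^ (2 * m), 0, 1⟩]

variable {m : ℕ} {J : List ℕ} {N : ℕ → ℚ}

theorem mem_rankTable {r : Row} :
    r ∈ rankTable m J N ↔
      (∃ j ∈ J, ∃ ε : ℤˣ, r = ⟨(ε : ℤ) * 2 ^ (m + j), (2 ^ (2 * m) - (ε : ℤ) * 2 ^ (m + j)) / 2,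
        N j * ((2 ^ m / 2 ^ j) ^ 2 + (ε : ℤ) * (2 ^ m / 2 ^ j)) / 2⟩) ∨
      r = ⟨0, 2 ^ (2 * m) / 2,
        2 ^ (2 * m) - 1 + (J.map fun j => N j * (2 ^ (2 * m) - (2 ^ m / 2 ^ j) ^ 2)).sum⟩ ∨
      r = ⟨2 ^ (2 * m), 0, 1⟩ := by
  have exists_unit {P : ℤˣ → Prop} : (∃ ε, P ε) ↔ P 1 ∨ P (-1) :=
    ⟨fun ⟨ε, h⟩ => by obtain rfl | rfl := Int.units_eq_one_or ε <;> simp [h],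
      (·.elim (⟨_, ·⟩) (⟨_, ·⟩))⟩
  simp [rankTable, exists_unit]

theorem weight_of_mem_rankTable {r : Row} (hr : r ∈ rankTable m J N) :
    r.weight = (2 ^ (2 * m) - r.value) / 2 := by
  obtain ⟨j, -, ε, rfl⟩ | rfl | rfl := mem_rankTable.1 hr <;> simp

variable {F : Type*} [Field F] [Fintype F] [Algebra (ZMod 2) F] {n k : ℕ} {π : F}
  (hn : n = 2 * m) (hF : Fintype.card F = 2 ^ n)

theorem exists_mem_rankTable_value_eq (h_lt : (2 * m).gcd (m + k) < m)
    (hJ : ∀ (α : subfieldPow F m) (β : F),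
      ∃ j ∈ m :: J, Module.finrank (ZMod 2) (radical k α β) = 2 * j)
    (α : subfieldPow F m) (β γ : F) :
    ∃ r ∈ rankTable m J N, (expSum hn hF k α β γ : ℚ) = r.value := by
  have hm : Module.finrank (ZMod 2) F = 2 * m := (finrank_eq_of_card hF).trans hn
  have h_neg : expSum hn hF k α β γ ≠ -2 ^ (m + m) := fun h => by
    have h_card := two_mul_natCard_triples (k := k) hn hF le_rfl (-1)
    rw [pairCount_self hm h_lt] at h_card
    norm_num [Finite.card_eq_zero_iff] at h_card
    exact h_card.false ⟨(α, β, γ), h⟩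
  obtain ⟨j, hj, h_rad⟩ := hJ α β
  have h_values := expSum_eq_of_finrank_radical hn hF h_rad γ
  obtain h_zero | h_ne := eq_or_ne (expSum hn hF k α β γ) 0
  · exact ⟨_, mem_rankTable.2 (.inr (.inl rfl)), by simp [h_zero]⟩
  obtain rfl | hj := List.mem_cons.1 hj
  · have h := h_values.resolve_right (not_or.2 ⟨h_neg, h_ne⟩)
    exact ⟨_, mem_rankTable.2 (.inr (.inr rfl)), by simp [h, two_mul]⟩
  · obtain h | h | h := h_values
    · exact ⟨_, mem_rankTable.2 (.inl ⟨j, hj, 1, rfl⟩), by simp [h]⟩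
    · exact ⟨_, mem_rankTable.2 (.inl ⟨j, hj, -1, rfl⟩), by simp [h]⟩
    · exact absurd h h_ne

theorem mult_of_mem_rankTable (h_lt : (2 * m).gcd (m + k) < m) (hJ_nodup : (m :: J).Nodup)
    (hJ_le : ∀ j ∈ J, j ≤ m)
    (hJ : ∀ (α : subfieldPow F m) (β : F),
      ∃ j ∈ m :: J, Module.finrank (ZMod 2) (radical k α β) = 2 * j)
    {r : Row} (hr : r ∈ rankTable m J fun j => pairCount F m k j) :
    (Nat.card {t : subfieldPow F m × F × F //
      (expSum hn hF k t.1 t.2.1 t.2.2 : ℚ) = r.value} : ℚ) = r.mult := by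
  have hm : Module.finrank (ZMod 2) F = 2 * m := (finrank_eq_of_card hF).trans hn
  have natCard_congr {q : ℚ} (v : ℤ) (h : q = v) :
      Nat.card {t : subfieldPow F m × F × F // (expSum hn hF k t.1 t.2.1 t.2.2 : ℚ) = q} =
        Nat.card {t : subfieldPow F m × F × F // expSum hn hF k t.1 t.2.1 t.2.2 = v} := by
    rw [h]
    exact Nat.card_congr (Equiv.subtypeEquivRight fun t => Int.cast_inj)
  have div_eq {j : ℕ} (hj : j ≤ m) : (2 : ℚ) ^ m / 2 ^ j = 2 ^ (m - j) := by
    rw [pow_sub₀ _ two_ne_zero hj, div_eq_mul_inv]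
  obtain ⟨j, hj, ε, rfl⟩ | rfl | rfl := mem_rankTable.1 hr
  · rw [natCard_congr (ε * 2 ^ (m + j)) (by push_cast; rfl), eq_div_iff two_ne_zero, mul_comm,
      div_eq (hJ_le j hj), ← pow_mul']
    exact mod_cast two_mul_natCard_triples hn hF (hJ_le j hj) ε
  · have h_card := natCard_triples_zero hn hF (J := (m :: J).toFinset) (by simpa using hJ)
    rw [List.sum_toFinset _ hJ_nodup, List.map_cons, List.sum_cons, pairCount_self hm h_lt,
      Nat.sub_self] at h_card
    have h_map : (J.map fun j => (pairCount F m k j : ℚ) * (2 ^ (2 * m) - (2 ^ m / 2 ^ j) ^ 2)) =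
        J.map fun j => (pairCount F m k j : ℚ) * (2 ^ (2 * m) - 2 ^ (2 * m - 2 * j)) :=
      List.map_congr_left fun j hj => by rw [div_eq (hJ_le j hj), ← pow_mul', Nat.mul_sub]
    have h_card_rat := congrArg (Int.cast : ℤ → ℚ) h_card
    push_cast [List.map_map] at h_card_rat
    rw [natCard_congr 0 Int.cast_zero.symm, h_map]
    simpa [Function.comp_def] using h_card_rat
  · have h_card := two_mul_natCard_triples (k := k) hn hF le_rfl 1
    rw [pairCount_self hm h_lt] at h_card
    rw [natCard_congr (2 ^ (m + m)) (by push_cast; ring)]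
    norm_num at h_card
    rw [h_card, Nat.cast_one]

theorem isDistribution_rankTable (hπ : IsPrimitiveRoot π (2 ^ n - 1))
    (h_lt : (2 * m).gcd (m + k) < m) (hJ_nodup : (m :: J).Nodup) (hJ_le : ∀ j ∈ J, j ≤ m)
    (hJ : ∀ (α : subfieldPow F m) (β : F),
      ∃ j ∈ m :: J, Module.finrank (ZMod 2) (radical k α β) = 2 * j) :
    IsDistribution hn hF k π (rankTable m J fun j => pairCount F m k j) :=
  isDistribution_of_expSum hn hF hπ h_lt (fun _ hr => hn ▸ weight_of_mem_rankTable hr)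
    (exists_mem_rankTable_value_eq hn hF h_lt hJ)
    (fun _ hr => mult_of_mem_rankTable hn hF h_lt hJ_nodup hJ_le hJ hr)

end RankTable

section Tables

theorem two_zpow_ofNat_mul (c e : ℕ) [c.AtLeastTwo] :
    (2 : ℚ) ^ ((ofNat(c) : ℤ) * (e : ℤ)) = (2 ^ e) ^ (ofNat(c) : ℕ) := by
  rw [← zpow_natCast (2 ^ e), ← zpow_natCast 2 e, ← zpow_mul, mul_comm]
  rfl

theorem two_pow_sq_sub_one_ne_zero {d : ℕ} (hd : 0 < d) : ((2 : ℚ) ^ d) ^ 2 - 1 ≠ 0 :=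
  sub_ne_zero.2 (one_lt_pow₀ (one_lt_pow₀ one_lt_two hd.ne') two_ne_zero).ne'

variable {m d : ℕ} {N : ℕ → ℚ}

theorem rankTable_eq_tableOne (hd : 0 < d) (h_sum : 1 + (N 0 + N d) = (2 ^ m) ^ 3)
    (h_moment : (2 ^ m) ^ 2 + (N 0 + N d * (2 ^ d) ^ 2) =
      (2 ^ m) ^ 3 + ((2 ^ m) ^ 2 - 1) * (2 ^ m * 2 ^ d)) :
    rankTable m [0, d] N = tableOne (2 * m) m d := by
  have h_ne : ((2 : ℚ) ^ d) ^ 2 - 1 ≠ 0 := two_pow_sq_sub_one_ne_zero hd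
  have h_d : N d = (2 ^ m * 2 ^ d - 1) * ((2 ^ m) ^ 2 - 1) / ((2 ^ d) ^ 2 - 1) := by
    rw [eq_div_iff h_ne]
    linear_combination h_moment - h_sum
  have h_zero : N 0 = (2 ^ m) ^ 3 - 1 - N d := by linarith
  rw [h_d] at h_zero
  simp only [rankTable, tableOne, List.flatMap_cons, List.flatMap_nil, List.map_cons, List.map_nil,
    List.cons_append, List.nil_append, List.append_nil, List.cons.injEq, Row.mk.injEq,
    List.sum_cons, List.sum_nil, h_zero, h_d, zpow_add₀ (two_ne_zero (α := ℚ)),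
    zpow_sub₀ (two_ne_zero (α := ℚ)), two_zpow_ofNat_mul, zpow_natCast, zpow_one, pow_add,
    pow_mul', true_and, and_true]
  split_ands <;> field_simp <;> ring

theorem rankTable_eq_tableTwo (hd : 0 < d) (h_sum : 1 + (N 0 + (N d + N (2 * d))) = (2 ^ m) ^ 3)
    (h_signed : 2 ^ m - N 0 + N d * 2 ^ d - N (2 * d) * (2 ^ d) ^ 2 = (2 ^ m) ^ 2)
    (h_moment : (2 ^ m) ^ 2 + (N 0 + (N d * (2 ^ d) ^ 2 + N (2 * d) * (2 ^ d) ^ 4)) =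
      (2 ^ m) ^ 3 + ((2 ^ m) ^ 2 - 1) * (2 ^ m * 2 ^ d)) :
    rankTable m [0, d, 2 * d] N = tableTwo (2 * m) m d := by
  have h_ne : ((2 : ℚ) ^ d) ^ 2 - 1 ≠ 0 := two_pow_sq_sub_one_ne_zero hd
  have h_ne' : (2 : ℚ) ^ d + 1 ≠ 0 := by positivity
  have h_two_d : N (2 * d) = ((2 ^ m) ^ 2 - 1) * (2 ^ m - 2 ^ d) /
      (2 ^ d * (2 ^ d + 1) * ((2 ^ d) ^ 2 - 1)) := by
    rw [eq_div_iff (by positivity)]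
    linear_combination h_moment - h_sum - (2 ^ d - 1) * (h_sum + h_signed)
  have h_d : N d = ((2 ^ m) ^ 2 - 1) * (2 ^ m * ((2 ^ d) ^ 2 + 2 ^ d + 1) + (2 ^ d) ^ 2) /
      (2 ^ d * (2 ^ d + 1) ^ 2) := by
    rw [eq_div_iff (by positivity)]
    linear_combination h_moment - h_sum + ((2 ^ d) ^ 2 + 1) * (h_sum + h_signed)
  have h_zero : N 0 = (2 ^ m) ^ 3 - 1 - N d - N (2 * d) := by linarith
  rw [h_d, h_two_d] at h_zero
  simp only [rankTable, tableTwo, List.flatMap_cons, List.flatMap_nil, List.map_cons, List.map_nil,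
    List.cons_append, List.nil_append, List.append_nil, List.cons.injEq, Row.mk.injEq,
    List.sum_cons, List.sum_nil, h_zero, h_d, h_two_d, zpow_add₀ (two_ne_zero (α := ℚ)),
    zpow_sub₀ (two_ne_zero (α := ℚ)), two_zpow_ofNat_mul, zpow_natCast, zpow_one, pow_add,
    pow_mul', true_and, and_true]
  split_ands <;> field_simp <;> ring

end Tables

section Exponents

variable {m k : ℕ}

theorem gcd_two_mul_add (m k : ℕ) : (2 * m).gcd (m + k) = (m + k).gcd (2 * k) := by
  refine Nat.dvd_antisymm (Nat.dvd_gcd (Nat.gcd_dvd_right _ _) ?_)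
    (Nat.dvd_gcd ?_ (Nat.gcd_dvd_left _ _))
  · rw [← Nat.dvd_add_right (Nat.gcd_dvd_left (2 * m) (m + k)), ← mul_add]
    exact (Nat.gcd_dvd_right _ _).mul_left 2
  · rw [← Nat.dvd_add_left (Nat.gcd_dvd_right (m + k) (2 * k)), ← mul_add]
    exact (Nat.gcd_dvd_left _ _).mul_left 2

theorem gcd_two_mul_add_dvd (m k : ℕ) : (2 * m).gcd (m + k) ∣ 2 * m.gcd k := by
  rw [← Nat.gcd_mul_left]
  refine Nat.dvd_gcd (Nat.gcd_dvd_left _ _) ?_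
  rw [gcd_two_mul_add]
  exact Nat.gcd_dvd_right _ _

theorem gcd_two_mul_add_lt (hm : 0 < m) (h_ndvd : ¬m ∣ k) : (2 * m).gcd (m + k) < m := by
  have h_lt : m.gcd k < m :=
    (Nat.gcd_le_left k hm).lt_of_ne fun h => h_ndvd (Nat.gcd_eq_left_iff_dvd.1 h)
  have h_le : (2 * m).gcd (m + k) ≤ m := by
    refine (Nat.le_of_dvd (by positivity) (gcd_two_mul_add_dvd m k)).trans ?_
    have h_dvd := Nat.le_of_dvd (Nat.sub_pos_of_lt h_lt)
      (Nat.dvd_sub (Nat.gcd_dvd_left m k) dvd_rfl)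
    omega
  refine h_le.lt_of_ne fun h => h_ndvd ?_
  have h_dvd := Nat.gcd_dvd_right (2 * m) (m + k)
  rwa [h, Nat.dvd_add_self_left] at h_dvd

theorem odd_div_gcd (hm : 0 < m) (h : (2 * m).gcd (m + k) = 2 * m.gcd k) :
    Odd (m / m.gcd k) ∧ Odd (k / m.gcd k) := by
  have h_pos : 0 < m.gcd k := Nat.gcd_pos_of_pos_left _ hm
  have h_coprime : (m / m.gcd k).Coprime (k / m.gcd k) := Nat.coprime_div_gcd_div_gcd h_pos
  have h_even : 2 ∣ m / m.gcd k + k / m.gcd k := by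
    rw [← Nat.add_div_of_dvd_right (Nat.gcd_dvd_left m k)]
    exact Nat.dvd_div_of_mul_dvd (mul_comm 2 (m.gcd k) ▸ h ▸ Nat.gcd_dvd_right _ _)
  have h_iff : Even (m / m.gcd k) ↔ Even (k / m.gcd k) :=
    Nat.even_add.1 (even_iff_two_dvd.2 h_even)
  have h_odd : ¬Even (m / m.gcd k) := fun h_m =>
    Nat.not_coprime_of_dvd_of_dvd one_lt_two h_m.two_dvd (h_iff.1 h_m).two_dvd h_coprime
  exact ⟨Nat.not_even_iff_odd.1 h_odd, Nat.not_even_iff_odd.1 (h_iff.not.1 h_odd)⟩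

end Exponents

section Moments

variable {F : Type*} [Field F] [Finite F] [Algebra (ZMod 2) F] {m k : ℕ}

theorem exists_finrank_radical_eq (hm : Module.finrank (ZMod 2) F = 2 * m) (h_pos : 0 < m.gcd k)
    {c : ℕ} (hc : (2 * m).gcd (m + k) = c * m.gcd k) (α : subfieldPow F m) (β : F) :
    ∃ j ∈ m :: (List.range (c + 1)).map (· * m.gcd k),
      Module.finrank (ZMod 2) (radical k α β) = 2 * j := by
  obtain ⟨rfl, rfl⟩ | h_ne := em (α = 0 ∧ β = 0)
  · exact ⟨m, List.mem_cons_self, by rw [radical_zero, finrank_top, hm]⟩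
  obtain ⟨a, ha⟩ := two_mul_gcd_dvd_finrank_radical (k := k) hm α β
  have h_le := finrank_radical_le (k := k) hm (not_and_or.1 h_ne)
  rw [hc, ha, mul_assoc, mul_comm _ a] at h_le
  have h_a : a ≤ c := le_of_mul_le_mul_right (le_of_mul_le_mul_left h_le two_pos) h_pos
  exact ⟨a * m.gcd k, List.mem_cons_of_mem _ (List.mem_map_of_mem (by grind)), by rw [ha]; ring⟩

theorem one_add_sum_pairCount (hm : Module.finrank (ZMod 2) F = 2 * m)
    (h_lt : (2 * m).gcd (m + k) < m) {J : List ℕ} (hJ_nodup : (m :: J).Nodup)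
    (hJ : ∀ (α : subfieldPow F m) (β : F),
      ∃ j ∈ m :: J, Module.finrank (ZMod 2) (radical k α β) = 2 * j) :
    1 + (J.map fun j => (pairCount F m k j : ℚ)).sum = (2 ^ m) ^ 3 := by
  have h := sum_pairCount hm (J := (m :: J).toFinset) (by simpa using hJ)
  rw [List.sum_toFinset _ hJ_nodup, List.map_cons, List.sum_cons, pairCount_self hm h_lt] at h
  replace h := congrArg (Int.cast : ℤ → ℚ) h
  push_cast [List.map_map] at h
  simpa [pow_mul', Function.comp_def] using h

theorem sq_add_sum_pairCount_mul_sq (hm : Module.finrank (ZMod 2) F = 2 * m)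
    (h_lt : (2 * m).gcd (m + k) < m) {J : List ℕ} (hJ_nodup : (m :: J).Nodup)
    (hJ : ∀ (α : subfieldPow F m) (β : F),
      ∃ j ∈ m :: J, Module.finrank (ZMod 2) (radical k α β) = 2 * j) :
    (2 ^ m) ^ 2 + (J.map fun j => (pairCount F m k j * (2 ^ j) ^ 2 : ℚ)).sum =
      (2 ^ m) ^ 3 + ((2 ^ m) ^ 2 - 1) * (2 ^ m * 2 ^ m.gcd k) := by
  have h := sum_pairCount_mul_two_pow hm (J := (m :: J).toFinset) (by simpa using hJ)
  rw [List.sum_toFinset _ hJ_nodup, List.map_cons, List.sum_cons, pairCount_self hm h_lt] at h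
  replace h := congrArg (Int.cast : ℤ → ℚ) h
  push_cast [List.map_map] at h
  simpa [pow_mul', pow_add, Function.comp_def] using h

end Moments

section Distributions

variable {F : Type*} [Field F] [Fintype F] [Algebra (ZMod 2) F] {m k : ℕ} {π : F}

theorem isDistribution_tableOne (hF : Fintype.card F = 2 ^ (2 * m))
    (hπ : IsPrimitiveRoot π (2 ^ (2 * m) - 1)) (hm : 0 < m) (h_ndvd : ¬m ∣ k)
    (h_gcd : (2 * m).gcd (m + k) = m.gcd k) :
    IsDistribution rfl hF k π (tableOne (2 * m) m (m.gcd k : ℕ)) := by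
  have h_lt : (2 * m).gcd (m + k) < m := gcd_two_mul_add_lt hm h_ndvd
  have h_pos : 0 < m.gcd k := Nat.gcd_pos_of_pos_left k hm
  have h_finrank : Module.finrank (ZMod 2) F = 2 * m := finrank_eq_of_card hF
  have hJ (α : subfieldPow F m) (β : F) :
      ∃ j ∈ [m, 0, m.gcd k], Module.finrank (ZMod 2) (radical k α β) = 2 * j := by
    simpa [List.range_succ] using
      exists_finrank_radical_eq h_finrank h_pos (c := 1) (by rwa [one_mul]) α β
  have h_nodup : [m, 0, m.gcd k].Nodup := by grind
  have h_sum := one_add_sum_pairCount h_finrank h_lt h_nodup hJ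
  have h_moment := sq_add_sum_pairCount_mul_sq h_finrank h_lt h_nodup hJ
  have h_table : rankTable m [0, m.gcd k] (fun j => pairCount F m k j) =
      tableOne (2 * m) m (m.gcd k : ℕ) :=
    rankTable_eq_tableOne h_pos (by simpa using h_sum) (by simpa using h_moment)
  exact h_table ▸ isDistribution_rankTable rfl hF hπ h_lt h_nodup (by grind) hJ

theorem isDistribution_tableTwo (hF : Fintype.card F = 2 ^ (2 * m))
    (hπ : IsPrimitiveRoot π (2 ^ (2 * m) - 1)) (hm : 0 < m) (h_ndvd : ¬m ∣ k)
    (h_gcd : (2 * m).gcd (m + k) = 2 * m.gcd k) :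
    IsDistribution rfl hF k π (tableTwo (2 * m) m (m.gcd k : ℕ)) := by
  have h_lt : (2 * m).gcd (m + k) < m := gcd_two_mul_add_lt hm h_ndvd
  have h_pos : 0 < m.gcd k := Nat.gcd_pos_of_pos_left k hm
  have h_finrank : Module.finrank (ZMod 2) F = 2 * m := finrank_eq_of_card hF
  have hJ (α : subfieldPow F m) (β : F) :
      ∃ j ∈ [m, 0, m.gcd k, 2 * m.gcd k],
        Module.finrank (ZMod 2) (radical k α β) = 2 * j := by
    simpa [List.range_succ] using exists_finrank_radical_eq h_finrank h_pos h_gcd α β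
  have h_nodup : [m, 0, m.gcd k, 2 * m.gcd k].Nodup := by grind
  have h_sum := one_add_sum_pairCount h_finrank h_lt h_nodup hJ
  have h_moment := sq_add_sum_pairCount_mul_sq h_finrank h_lt h_nodup hJ
  have h_signed : (2 ^ m - pairCount F m k 0 + pairCount F m k (m.gcd k) * 2 ^ m.gcd k -
      pairCount F m k (2 * m.gcd k) * (2 ^ m.gcd k) ^ 2 : ℚ) = (2 ^ m) ^ 2 := by
    obtain ⟨h_odd_m, h_odd_k⟩ := odd_div_gcd hm h_gcd
    have h := sum_pairCount_signed rfl hF (J := [m, 0, m.gcd k, 2 * m.gcd k].toFinset)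
      (by simpa using hJ) h_odd_m h_odd_k
    rw [List.sum_toFinset _ h_nodup] at h
    replace h := congrArg (Int.cast : ℤ → ℚ) h
    simp only [List.map_cons, List.map_nil, List.sum_cons, List.sum_nil,
      pairCount_self h_finrank h_lt, h_odd_m.neg_one_pow, Nat.zero_div, Nat.div_self h_pos,
      Nat.mul_div_cancel _ h_pos] at h
    push_cast at h
    refine mul_left_cancel₀ (pow_ne_zero m (two_ne_zero (α := ℚ))) ?_
    linear_combination h
  have h_four : ((2 : ℚ) ^ (2 * m.gcd k)) ^ 2 = (2 ^ m.gcd k) ^ 4 := by ring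
  have h_table : rankTable m [0, m.gcd k, 2 * m.gcd k] (fun j => pairCount F m k j) =
      tableTwo (2 * m) m (m.gcd k : ℕ) :=
    rankTable_eq_tableTwo h_pos (by simpa using h_sum) h_signed (by simpa [h_four] using h_moment)
  exact h_table ▸ isDistribution_rankTable rfl hF hπ h_lt h_nodup (by grind) hJ

end Distributions

end GenKasami

end

theorem mainTheorem3_general {F : Type*} [Field F] [Fintype F] [Algebra (ZMod 2) F]
    (n m k d d' : ℕ) (hn : n = 2 * m) (hF : Fintype.card F = 2 ^ n) (h_ndvd : ¬m ∣ k)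
    (hd : d = Nat.gcd m k) (hd' : d' = Nat.gcd (m + k) (2 * k))
    (π : F) (hπ : IsPrimitiveRoot π (2 ^ n - 1)) :
    (Function.Injective
        (fun p : GenKasami.subfieldPow F m × F × F =>
          GenKasami.word hn hF k π p.1 p.2.1 p.2.2) ∧
      Set.range
        (fun p : GenKasami.subfieldPow F m × F × F =>
          GenKasami.word hn hF k π p.1 p.2.1 p.2.2) =
        (GenKasami.codeC2 n m k π : Set (Fin (2 ^ n - 1) → ZMod 2))) ∧
    (d' = d → GenKasami.IsDistribution hn hF k π (GenKasami.tableOne n m d)) ∧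
    (d' = 2 * d → GenKasami.IsDistribution hn hF k π (GenKasami.tableTwo n m d)) := by
  subst hn hd hd'
  have hm : 0 < m := Nat.pos_of_ne_zero fun h => by simpa [h] using GenKasami.two_pow_sub_one_pos hF
  have h_lt : (2 * m).gcd (m + k) < m := GenKasami.gcd_two_mul_add_lt hm h_ndvd
  rw [← GenKasami.gcd_two_mul_add, Nat.cast_mul, Nat.cast_ofNat]
  exact ⟨⟨GenKasami.wordHom_injective rfl hF hπ h_lt, GenKasami.range_wordHom rfl hF hπ h_lt⟩,
    GenKasami.isDistribution_tableOne hF hπ hm h_ndvd,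
    GenKasami.isDistribution_tableTwo hF hπ hm h_ndvd⟩

theorem mainTheorem3 {F : Type*} [Field F] [Fintype F] [Algebra (ZMod 2) F]
    (n m k d d' : ℕ) (hn : n = 2 * m) (hF : Fintype.card F = 2 ^ n)
    (hk1 : 1 ≤ k) (hkn : k ≤ n - 1) (hkm : k ≠ m)
    (hd : d = Nat.gcd m k) (hd' : d' = Nat.gcd (m + k) (2 * k))
    (π : F) (hπ : IsPrimitiveRoot π (2 ^ n - 1)) :
    (Function.Injective
        (fun p : GenKasami.subfieldPow F m × F × F =>
          GenKasami.word hn hF k π p.1 p.2.1 p.2.2) ∧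
      Set.range
        (fun p : GenKasami.subfieldPow F m × F × F =>
          GenKasami.word hn hF k π p.1 p.2.1 p.2.2) =
        (GenKasami.codeC2 n m k π : Set (Fin (2 ^ n - 1) → ZMod 2))) ∧
    (d' = d → GenKasami.IsDistribution hn hF k π (GenKasami.tableOne n m d)) ∧
    (d' = 2 * d → GenKasami.IsDistribution hn hF k π (GenKasami.tableTwo n m d)) :=
  mainTheorem3_general n m k d d' hn hF
    (fun ⟨c, hc⟩ => by obtain _ | _ | c := c <;> grind) hd hd' π hπ
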